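/- Let $p,k\ge 1$ be fixed, and let $\mathcal S_p(\mathbb R)$ be the space of real symmetric $p\times p$ matrices, with its Borel $\sigma$-field and with the measure $dX=\prod_{i\le j}dx_{ij}$. A (normalized) matrix measure on $[0,1]$ is a $p\times p$ matrix $\mu=(\mu_{ij})$ of signed Borel measures on $[0,1]$ such that $\mu(B)$ is symmetric and nonnegative definite for each Borel set $B\subset[0,1]$, and $\mu([0,1])=I_p$. Let $$\mathcal M_n(\mathbb R)=\Big\{(S_1,\dots,S_n)^T\ \Big|\ S_j=\int_0^1x^j\,d\mu(x),\ j=1,\dots,n,\ \text{for some matrix measure }\mu\Big\}\subset(\mathcal S_p(\mathbb R))^n .$$ For each $n$ let $(S_{1,n},\dots,S_{n,n})^T$ be a random vector that is uniformly distributed on $\mathcal M_n(\mathbb R)$ with respect to $dS_1\cdots dS_n$, and for $n\ge k$ put $\mathbf S_{k,n}=(S_{1,n},\dots,S_{k,n})^T$. Let $\mathbf S^0_k=(s^0_1I_p,\dots,s^0_kI_p)^T$, where $s^0_m=\int_0^1\frac{x^m\,dx}{\pi\sqrt{x(1-x)}}$ is the $m$-th moment of the arcsine distribution, and let $A$ be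 the lower triangular $k\times k$ matrix with entries $a_{ij}=2^{-2i+2}\binom{2i}{i-j}$ for $1\le j\le i\le k$ (and $a_{ij}=0$ for $j>i$). Then $$\sqrt{4n(p+1)}\,(A^{-1}\otimes I_p)(\mathbf S_{k,n}-\mathbf S^0_k)\ \xrightarrow[n\to\infty]{\mathcal D}\ \mathbf G ,$$ where $\mathbf G=(G_1,\dots,G_k)^T$ and $G_1,\dots,G_k$ are independent random elements of $\mathcal S_p(\mathbb R)$, each distributed according to the Gaussian orthogonal ensemble, i.e. with density $$f(X)=(2\pi)^{-p/2}\,\pi^{-p(p-1)/4}\,e^{-\frac12\operatorname{tr}X^2}$$ with respect to $dX$. -/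

import Mathlib

open MeasureTheory ProbabilityTheory Filter

noncomputable section

/-- The real vector space of symmetric `p × p` real matrices, as a subspace of all matrices. -/
def symSubmodule (p : ℕ) : Submodule ℝ (Matrix (Fin p) (Fin p) ℝ) where
  carrier := {X | X.IsSymm}
  add_mem' := fun hX hY => Matrix.IsSymm.add hX hY
  zero_mem' := Matrix.transpose_zero
  smul_mem' := fun c _ hX => Matrix.IsSymm.smul hX c

/-- The space of symmetric `p × p` real matrices. Its topology is that of entrywise convergence,
i.e. the topology of the Frobenius norm. -/
abbrev SymMat (p : ℕ) : Type := symSubmodule p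

/-- The Borel sigma-algebra on the symmetric matrices. -/
instance SymMat.instMeasurableSpace (p : ℕ) : MeasurableSpace (SymMat p) := borel _

instance SymMat.instBorelSpace (p : ℕ) : BorelSpace (SymMat p) := ⟨rfl⟩

instance SymMat.instSecondCountable (p : ℕ) : SecondCountableTopology (SymMat p) :=
  haveI : SecondCountableTopology (Matrix (Fin p) (Fin p) ℝ) :=
    inferInstanceAs (SecondCountableTopology (Fin p → Fin p → ℝ))
  TopologicalSpace.Subtype.secondCountableTopology {X | X ∈ symSubmodule p}

/-- The index set of the entries on and above the diagonal of a `p × p` matrix. -/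
abbrev UpperIdx (p : ℕ) : Type := {q : Fin p × Fin p // q.1 ≤ q.2}

/-- The symmetric matrix with prescribed entries `x_{ij}`, `i ≤ j`. -/
def symOfUpper (p : ℕ) (x : UpperIdx p → ℝ) : SymMat p :=
  ⟨Matrix.of fun i j => x ⟨(min i j, max i j), min_le_max⟩, by
    change Matrix.transpose _ = _
    ext i j
    simp [Matrix.transpose_apply, min_comm, max_comm]⟩

theorem measurable_symOfUpper (p : ℕ) : Measurable (symOfUpper p) := by
  have h : Continuous (symOfUpper p) :=
    Continuous.subtype_mk (continuous_matrix fun i j =>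
      continuous_apply (⟨(min i j, max i j), min_le_max⟩ : UpperIdx p)) _
  exact h.measurable

/-- The measure `dX = ∏_{i ≤ j} dx_{ij}` on the symmetric matrices: the product Lebesgue measure
with respect to the entries on and above the diagonal. -/
def symVolume (p : ℕ) : Measure (SymMat p) :=
  Measure.map (symOfUpper p) (volume : Measure (UpperIdx p → ℝ))

/-- The measure `dS_1 ⋯ dS_n` on `n`-tuples of symmetric matrices. -/
def symTupleVolume (p n : ℕ) : Measure (Fin n → SymMat p) :=
  Measure.pi fun _ => symVolume p

/-- A normalized real `p × p` matrix measure on `[0,1]`: a matrix of signed measures on `[0,1]`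
whose value on every Borel set is symmetric and nonnegative definite, with total mass the
identity. (`Matrix.PosSemidef` includes symmetry.) -/
structure MatrixMeasure (p : ℕ) where
  /-- The entries of the matrix measure. -/
  entry : Fin p → Fin p → SignedMeasure (Set.Icc (0 : ℝ) 1)
  posSemidef : ∀ B : Set (Set.Icc (0 : ℝ) 1), MeasurableSet B →
    (Matrix.of fun i j => entry i j B).PosSemidef
  normalized : (Matrix.of fun i j => entry i j Set.univ) = (1 : Matrix (Fin p) (Fin p) ℝ)

/-- The `m`-th moment `∫ x^m dμ(x)` of a matrix measure, taken entrywise. -/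
def MatrixMeasure.moment {p : ℕ} (μ : MatrixMeasure p) (m : ℕ) : Matrix (Fin p) (Fin p) ℝ :=
  Matrix.of fun i j => ∫ᵛ x, (x : ℝ) ^ m ∂<•(μ.entry i j)

/-- The `n`-th moment space: all tuples `(S_1, …, S_n)` of moments of matrix measures on `[0,1]`.
The tuple is indexed from `0`, so that position `j` holds the moment of order `j + 1`. -/
def momentSpace (p n : ℕ) : Set (Fin n → SymMat p) :=
  {S | ∃ μ : MatrixMeasure p, ∀ j : Fin n,
    (S j : Matrix (Fin p) (Fin p) ℝ) = μ.moment ((j : ℕ) + 1)}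

/-- The Gaussian orthogonal ensemble: the law on symmetric matrices with density
`(2π)^{-p/2} π^{-p(p-1)/4} exp(-tr(X²)/2)` with respect to `dX`. -/
def goe (p : ℕ) : Measure (SymMat p) :=
  (symVolume p).withDensity fun X => ENNReal.ofReal
    ((2 * Real.pi) ^ (-(p : ℝ) / 2) * Real.pi ^ (-((p : ℝ) * ((p : ℝ) - 1)) / 4) *
      Real.exp (-(1 / 2) * Matrix.trace ((X : Matrix (Fin p) (Fin p) ℝ) ^ 2)))

/-- The `m`-th moment of the arcsine distribution on `[0,1]`. -/
def arcsineMoment (m : ℕ) : ℝ :=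
  ∫ x in (0 : ℝ)..1, x ^ m / (Real.pi * √(x * (1 - x)))

/-- The vector `(s⁰_1 I_p, …, s⁰_k I_p)`, indexed from `0`. -/
def arcsineCenter (p k : ℕ) : Fin k → SymMat p :=
  fun i => arcsineMoment ((i : ℕ) + 1) • ⟨1, Matrix.transpose_one⟩

/-- The `k × k` lower triangular matrix with entries `a_{ij} = 2^{-2i+2} (2i choose i-j)` for
`j ≤ i`, where the indices in this formula are `i + 1` and `j + 1` for `i j : Fin k`. -/
def coeffMatrix (k : ℕ) : Matrix (Fin k) (Fin k) ℝ :=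
  Matrix.of fun i j =>
    if j ≤ i then
      (2 : ℝ) ^ (-2 * (((i : ℕ) : ℤ) + 1) + 2) *
        (Nat.choose (2 * ((i : ℕ) + 1)) (((i : ℕ) + 1) - ((j : ℕ) + 1)) : ℝ)
    else 0

/-- The column of blocks `(X_1, …, X_k)^T`, a `kp × p` matrix. -/
def blockColumn {p k : ℕ} (X : Fin k → SymMat p) : Matrix (Fin k × Fin p) (Fin p) ℝ :=
  Matrix.of fun a j => (X a.1 : Matrix (Fin p) (Fin p) ℝ) a.2 j

/-- The action of `B ⊗ I_p` on vectors of symmetric matrices: the `i`-th block of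
`(B ⊗ I_p) X` is `∑_j b_{ij} X_j`, which is again symmetric. -/
def kronAct {p k : ℕ} (B : Matrix (Fin k) (Fin k) ℝ) (X : Fin k → SymMat p) : Fin k → SymMat p :=
  fun i => ∑ j, B i j • X j

/-- `kronAct` is multiplication of the block column by the Kronecker product `B ⊗ I_p`. -/
theorem blockColumn_kronAct {p k : ℕ} (B : Matrix (Fin k) (Fin k) ℝ) (X : Fin k → SymMat p) :
    blockColumn (kronAct B X) =
      Matrix.kronecker B (1 : Matrix (Fin p) (Fin p) ℝ) * blockColumn X := by
  ext ⟨i, a⟩ b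
  simp [blockColumn, kronAct, Matrix.mul_apply, Fintype.sum_prod_type, Matrix.one_apply,
    Matrix.sum_apply]

end

/-! With x = (1 + cos θ)/2 the moment problem on [0,1] becomes trigonometric. The powers of x expand
triangularly in the cos jθ, with constant terms s⁰_m and coefficient matrix A/2, so S = S⁰ + (1/2)(A
⊗ I)X, where X_j are the Chebyshev moments of the matrix measure (`momentParam`). The admissible X
are exactly those whose block Toeplitz matrix with blocks X_{|i-j|}, X_0 = I, is nonnegative
definite (`momentSpace_eq_image`). Hence X is uniform on `toeplitzDomain`, up to a null boundary,
and √(4n(p+1)) A⁻¹ applied to S - S⁰ is √(n(p+1)) X.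

The volume computation is recursive. Given the earlier coefficients, the next one ranges over a
matrix interval with centre M and radius E, a Schur complement. The substitution M + L Z Lᵀ with L
Lᵀ = E turns this into -1 < Z < 1, with Jacobian (det E)^((p+1)/2). The ratio D of the last two
Toeplitz determinants is det E before the step and det E · det(1+Z) · det(1-Z) after it. Integrating
out one coefficient therefore turns the weight D^s into a constant times D^(s+(p+1)/2)
(`lintegral_toeplitzWeight_snoc`). Starting at s = 0, the first k coefficients have density
proportional to D^((n-k)(p+1)/2).

Near the origin log D(εy) = -ε² ∑ tr y_i² + o(ε²) (`tendsto_log_toeplitzRatio`). For ε =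
(n(p+1))^(-1/2) the exponent times ε² tends to 1/2, so the rescaled density tends pointwise to
exp(-(1/2) ∑ tr y_i²), the product of GOE densities up to a constant. The global bound
`toeplitzRatio_le` gives Gaussian domination, and Scheffé's principle
(`tendsto_probabilityMeasure_of_tendsto_density`) concludes. No normalising constant has to be
computed, since all measures involved have mass one. -/

noncomputable section

/-! ### Schur complements and symmetric two-by-two block matrices -/

section SchurComplement

open Matrix

variable {m n : Type*} [Fintype m] [Fintype n] [DecidableEq m] [DecidableEq n]

/-- A block matrix with positive definite corner is positive definite iff its Schur complement is. -/
theorem posDef_fromBlocks_iff_schur {A : Matrix m m ℝ} (hA : A.PosDef) (B : Matrix m n ℝ)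
    (D : Matrix n n ℝ) :
    (fromBlocks A B Bᵀ D).PosDef ↔ (D - Bᵀ * A⁻¹ * B).PosDef := by
  let _ : Invertible A := hA.isUnit.invertible
  have hdet : (fromBlocks A B Bᵀ D).det = A.det * (D - Bᵀ * A⁻¹ * B).det := by
    rw [det_fromBlocks₁₁, invOf_eq_nonsing_inv]
  have hpsd := PosDef.fromBlocks₁₁ B D hA
  rw [conjTranspose_eq_transpose_of_trivial] at hpsd
  have hA0 : IsUnit A.det := (isUnit_iff_isUnit_det A).1 hA.isUnit
  constructor
  · intro h
    refine (hpsd.1 h.posSemidef).posDef_iff_isUnit.2 ?_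
    have h1 := (isUnit_iff_isUnit_det _).1 h.isUnit
    rw [hdet] at h1
    exact (isUnit_iff_isUnit_det _).2 (isUnit_of_mul_isUnit_right h1)
  · intro h
    refine (hpsd.2 h.posSemidef).posDef_iff_isUnit.2 ?_
    rw [isUnit_iff_isUnit_det, hdet]
    exact hA0.mul ((isUnit_iff_isUnit_det _).1 h.isUnit)

theorem det_fromBlocks_schur {A : Matrix m m ℝ} (hA : A.PosDef) (B : Matrix m n ℝ)
    (D : Matrix n n ℝ) :
    (fromBlocks A B Bᵀ D).det = A.det * (D - Bᵀ * A⁻¹ * B).det := by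
  let _ : Invertible A := hA.isUnit.invertible
  rw [det_fromBlocks₁₁, invOf_eq_nonsing_inv]

/-- Subtracting the first block row from the second and adding the second block column to the first
makes the matrix block triangular with diagonal E + X, E - X. -/
theorem det_fromBlocks_swap_symm (E X : Matrix n n ℝ) :
    (fromBlocks E X X E).det = (E + X).det * (E - X).det := by
  have h : fromBlocks 1 0 (-1) 1 * fromBlocks E X X E * fromBlocks 1 0 1 1
      = fromBlocks (E + X) X 0 (E - X) := by
    simp only [fromBlocks_multiply]
    congr 1 <;> simp <;> abel
  have h2 := congrArg det h
  rw [det_mul, det_mul, det_fromBlocks_zero₁₂, det_fromBlocks_zero₁₂, det_fromBlocks_zero₂₁] at h2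
  simpa using h2

/-- Conjugation by the symmetric matrix P = (1, 1; 1, -1), invertible because P² = 2,
block-diagonalises into 2(E + X) and 2(E - X). -/
theorem posDef_fromBlocks_swap_symm {E X : Matrix n n ℝ} :
    (fromBlocks E X X E).PosDef ↔ (E + X).PosDef ∧ (E - X).PosDef := by
  set P : Matrix (n ⊕ n) (n ⊕ n) ℝ := fromBlocks 1 1 1 (-1) with hP
  have hPP : P * P = (2 : ℝ) • 1 := by
    rw [hP, fromBlocks_multiply, ← fromBlocks_one, fromBlocks_smul]
    congr 1 <;> simp [two_smul]
  have hPu : IsUnit P := by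
    rw [isUnit_iff_isUnit_det]
    have := congrArg det hPP
    rw [det_mul, det_smul] at this
    refine isUnit_iff_ne_zero.2 fun h => ?_
    rw [h, det_one, zero_mul, mul_one] at this
    exact (pow_ne_zero _ two_ne_zero) this.symm
  have hstar : star P = P := by
    rw [star_eq_conjTranspose, hP, fromBlocks_conjTranspose]
    simp
  have hmul : star P * fromBlocks E X X E * P =
      fromBlocks ((2 : ℝ) • (E + X)) 0 0 ((2 : ℝ) • (E - X)) := by
    rw [hstar, hP]
    simp only [fromBlocks_multiply]
    congr 1 <;> simp [two_smul] <;> abel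
  rw [← hPu.posDef_star_left_conjugate_iff, hmul]
  have key : ∀ F G : Matrix n n ℝ, (fromBlocks F 0 0 G).PosDef ↔ F.PosDef ∧ G.PosDef := by
    intro F G
    have h1 : (fromBlocks F 0 0 G).PosDef → F.PosDef := fun h => by
      have := h.submatrix (e := Sum.inl) Sum.inl_injective
      rwa [show (fromBlocks F 0 0 G).submatrix Sum.inl Sum.inl = F from rfl] at this
    have h2 : F.PosDef → ((fromBlocks F 0 0 G).PosDef ↔ G.PosDef) := fun h => by
      have := posDef_fromBlocks_iff_schur h (0 : Matrix n n ℝ) G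
      simpa using this
    exact ⟨fun h => ⟨h1 h, (h2 (h1 h)).1 h⟩, fun h => (h2 h.1).2 h.2⟩
  rw [key]
  have hs : ∀ F : Matrix n n ℝ, ((2 : ℝ) • F).PosDef ↔ F.PosDef := fun F =>
    ⟨fun h => by simpa [smul_smul] using h.smul (show (0 : ℝ) < 2⁻¹ by norm_num),
      fun h => h.smul two_pos⟩
  rw [hs, hs]

end SchurComplement

/-! ### Block Toeplitz matrices: extension by one block -/

section BlockToeplitz

open Matrix

variable {p N : ℕ}

/-- The block Toeplitz matrix with blocks `c |i - j|`. -/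
def blockToeplitz (c : ℕ → Matrix (Fin p) (Fin p) ℝ) (N : ℕ) :
    Matrix (Fin N × Fin p) (Fin N × Fin p) ℝ :=
  Matrix.of fun a b => c ((a.1 : ℤ) - b.1).natAbs a.2 b.2

/-- The block column `(c 1, …, c N)`. -/
def toeplitzCol (c : ℕ → Matrix (Fin p) (Fin p) ℝ) (N : ℕ) : Matrix (Fin N × Fin p) (Fin p) ℝ :=
  Matrix.of fun a j => c (a.1 + 1) a.2 j

/-- The block column `(c N, …, c 1)`. -/
def toeplitzRevCol (c : ℕ → Matrix (Fin p) (Fin p) ℝ) (N : ℕ) :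
    Matrix (Fin N × Fin p) (Fin p) ℝ :=
  Matrix.of fun a j => c (N - a.1) a.2 j

/-- The Schur complement of the block Toeplitz matrix of size `N` in that of size `N + 1`. -/
def toeplitzSchur (c : ℕ → Matrix (Fin p) (Fin p) ℝ) (N : ℕ) : Matrix (Fin p) (Fin p) ℝ :=
  1 - (toeplitzCol c N)ᵀ * (blockToeplitz c N)⁻¹ * toeplitzCol c N

/-- The centre of the range of the next coefficient of a positive block Toeplitz matrix. -/
def toeplitzCenter (c : ℕ → Matrix (Fin p) (Fin p) ℝ) (N : ℕ) : Matrix (Fin p) (Fin p) ℝ :=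
  (toeplitzCol c N)ᵀ * (blockToeplitz c N)⁻¹ * toeplitzRevCol c N

/-- The indices of a block matrix split into the later blocks and the first block. -/
def succBlockEquiv (p N : ℕ) : (Fin N × Fin p) ⊕ Fin p ≃ Fin (N + 1) × Fin p :=
  Equiv.ofBijective (Sum.elim (fun a => (a.1.succ, a.2)) fun j => (0, j)) (by
    constructor
    · rintro (⟨i, a⟩ | j) (⟨i', a'⟩ | j') h <;>
        simp_all [Fin.succ_ne_zero, (Fin.succ_ne_zero _).symm]
    · rintro ⟨i, a⟩
      induction i using Fin.cases with
      | zero => exact ⟨Sum.inr a, rfl⟩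
      | succ i => exact ⟨Sum.inl (i, a), rfl⟩)

/-- The indices of a block matrix split into the inner blocks, the first and the last block. -/
def innerBlockEquiv (p N : ℕ) : (Fin N × Fin p) ⊕ (Fin p ⊕ Fin p) ≃ Fin (N + 2) × Fin p :=
  Equiv.ofBijective (Sum.elim (fun a => (a.1.castSucc.succ, a.2))
    (Sum.elim (fun j => (0, j)) fun j => (Fin.last (N + 1), j))) (by
    constructor
    · rintro (⟨i, a⟩ | j | j) (⟨i', a'⟩ | j' | j') h <;>
        simp_all [Prod.ext_iff, Fin.ext_iff] <;> omega
    · rintro ⟨i, a⟩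
      induction i using Fin.cases with
      | zero => exact ⟨Sum.inr (Sum.inl a), rfl⟩
      | succ i =>
        induction i using Fin.lastCases with
        | last => exact ⟨Sum.inr (Sum.inr a), rfl⟩
        | cast i => exact ⟨Sum.inl (i, a), rfl⟩)

@[simp]
theorem succBlockEquiv_inl (a : Fin N × Fin p) :
    succBlockEquiv p N (Sum.inl a) = (a.1.succ, a.2) := rfl

@[simp]
theorem succBlockEquiv_inr (j : Fin p) : succBlockEquiv p N (Sum.inr j) = (0, j) := rfl

@[simp]
theorem innerBlockEquiv_inl (a : Fin N × Fin p) :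
    innerBlockEquiv p N (Sum.inl a) = (a.1.castSucc.succ, a.2) := rfl

@[simp]
theorem innerBlockEquiv_inr_inl (j : Fin p) :
    innerBlockEquiv p N (Sum.inr (Sum.inl j)) = (0, j) := rfl

@[simp]
theorem innerBlockEquiv_inr_inr (j : Fin p) :
    innerBlockEquiv p N (Sum.inr (Sum.inr j)) = (Fin.last (N + 1), j) := rfl

variable {c : ℕ → Matrix (Fin p) (Fin p) ℝ}

theorem blockToeplitz_submatrix_succ (hc : ∀ m, (c m).IsSymm) :
    (blockToeplitz c (N + 1)).submatrix (succBlockEquiv p N) (succBlockEquiv p N) =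
      fromBlocks (blockToeplitz c N) (toeplitzCol c N) (toeplitzCol c N)ᵀ (c 0) := by
  ext (⟨i, a⟩ | j) (⟨i', a'⟩ | j')
  · simp [blockToeplitz]
  · simp only [blockToeplitz, toeplitzCol, submatrix_apply, of_apply,
      fromBlocks_apply₁₂, succBlockEquiv_inl, succBlockEquiv_inr, Fin.val_succ,
      Fin.val_zero]
    congr 1
  · simp only [blockToeplitz, toeplitzCol, submatrix_apply, of_apply,
      fromBlocks_apply₂₁, succBlockEquiv_inl, succBlockEquiv_inr, Fin.val_succ,
      Fin.val_zero, transpose_apply]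
    rw [← (hc _).apply]
    congr 1
  · simp [blockToeplitz]

theorem blockToeplitz_submatrix_inner (hc : ∀ m, (c m).IsSymm) (h0 : c 0 = 1) :
    (blockToeplitz c (N + 2)).submatrix (innerBlockEquiv p N) (innerBlockEquiv p N) =
      fromBlocks (blockToeplitz c N) (fromCols (toeplitzCol c N) (toeplitzRevCol c N))
        (fromCols (toeplitzCol c N) (toeplitzRevCol c N))ᵀ
        (fromBlocks 1 (c (N + 1)) (c (N + 1)) 1) := by
  have key : ∀ (k l : ℕ) (a b : Fin p), k = l → c k a b = c l b a := by
    rintro k _ a b rfl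
    exact ((hc k).apply a b).symm
  have key' : ∀ (k l : ℕ) (a b : Fin p), k = l → c k a b = c l a b := by
    rintro k _ a b rfl
    rfl
  ext (⟨i, a⟩ | j | j) (⟨i', a'⟩ | j' | j')
  · simp [blockToeplitz]
  · simpa [blockToeplitz, toeplitzCol] using key' _ _ _ _ (by omega)
  · simpa [blockToeplitz, toeplitzRevCol] using key' _ _ _ _ (by omega)
  · simpa [blockToeplitz, toeplitzCol] using key _ _ _ _ (by omega)
  · simp [blockToeplitz, h0]
  · simpa [blockToeplitz] using key' _ _ _ _ (by omega)
  · simpa [blockToeplitz, toeplitzRevCol] using key _ _ _ _ (by omega)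
  · simpa [blockToeplitz] using key' _ _ _ _ (by omega)
  · simp [blockToeplitz, h0]

theorem blockToeplitz_isSymm (hc : ∀ m, (c m).IsSymm) : (blockToeplitz c N).IsSymm := by
  ext ⟨i, a⟩ ⟨j, b⟩
  simp only [blockToeplitz, transpose_apply, of_apply]
  rw [← (hc _).apply, ← Int.natAbs_neg, neg_sub]

theorem blockToeplitz_congr {c c' : ℕ → Matrix (Fin p) (Fin p) ℝ} (h : ∀ m < N, c m = c' m) :
    blockToeplitz c N = blockToeplitz c' N := by
  ext ⟨i, a⟩ ⟨j, b⟩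
  simp only [blockToeplitz, of_apply]
  rw [h _ (by omega)]

theorem toeplitzSchur_congr {c c' : ℕ → Matrix (Fin p) (Fin p) ℝ} (h : ∀ m ≤ N, c m = c' m) :
    toeplitzSchur c N = toeplitzSchur c' N := by
  have : toeplitzCol c N = toeplitzCol c' N := by
    ext ⟨i, a⟩ j
    simp only [toeplitzCol, of_apply]
    rw [h _ (by omega)]
  rw [toeplitzSchur, toeplitzSchur, this, blockToeplitz_congr fun m hm => h m hm.le]

theorem toeplitzCenter_congr {c c' : ℕ → Matrix (Fin p) (Fin p) ℝ} (h : ∀ m ≤ N, c m = c' m) :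
    toeplitzCenter c N = toeplitzCenter c' N := by
  have h1 : toeplitzCol c N = toeplitzCol c' N := by
    ext ⟨i, a⟩ j
    simp only [toeplitzCol, of_apply]
    rw [h _ (by omega)]
  have h2 : toeplitzRevCol c N = toeplitzRevCol c' N := by
    ext ⟨i, a⟩ j
    simp only [toeplitzRevCol, of_apply]
    rw [h _ (by omega)]
  rw [toeplitzCenter, toeplitzCenter, h1, h2, blockToeplitz_congr fun m hm => h m hm.le]

/-- Reversal of the order of the blocks. -/
def blockRev (p N : ℕ) : Fin N × Fin p ≃ Fin N × Fin p := Equiv.prodCongr Fin.revPerm (Equiv.refl _)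

theorem blockToeplitz_rev : (blockToeplitz c N).submatrix (blockRev p N) (blockRev p N) =
    blockToeplitz c N := by
  ext ⟨i, a⟩ ⟨j, b⟩
  simp only [blockToeplitz, blockRev, submatrix_apply, of_apply, Equiv.prodCongr_apply, Prod.map,
    Fin.revPerm_apply, Equiv.refl_apply, Fin.val_rev]
  congr 1
  omega

theorem toeplitzCol_rev : (toeplitzCol c N).submatrix (blockRev p N) id = toeplitzRevCol c N := by
  ext ⟨i, a⟩ j
  simp only [toeplitzCol, toeplitzRevCol, blockRev, submatrix_apply, of_apply, Equiv.prodCongr_apply,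
    Prod.map, Fin.revPerm_apply, Equiv.refl_apply, Fin.val_rev, id]
  congr 1
  omega

theorem toeplitzRevCol_rev :
    (toeplitzRevCol c N).submatrix (blockRev p N) id = toeplitzCol c N := by
  ext ⟨i, a⟩ j
  simp only [toeplitzCol, toeplitzRevCol, blockRev, submatrix_apply, of_apply, Equiv.prodCongr_apply,
    Prod.map, Fin.revPerm_apply, Equiv.refl_apply, Fin.val_rev, id]
  congr 1
  omega

/-- Reversing the blocks preserves |i - j|, hence the Toeplitz matrix and its inverse. This
identifies forward with backward Schur complements and makes the centre symmetric. -/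
theorem transpose_mul_inv_mul_rev {A B A' B' : Matrix (Fin N × Fin p) (Fin p) ℝ}
    (hA : A.submatrix (blockRev p N) id = A') (hB : B.submatrix (blockRev p N) id = B') :
    A'ᵀ * (blockToeplitz c N)⁻¹ * B' = Aᵀ * (blockToeplitz c N)⁻¹ * B := by
  have h : (blockToeplitz c N)⁻¹ =
      (blockToeplitz c N)⁻¹.submatrix (blockRev p N) (blockRev p N) := by
    rw [← inv_submatrix_equiv, blockToeplitz_rev]
  rw [h, ← hA, ← hB, transpose_submatrix, submatrix_mul_equiv, submatrix_mul_equiv, ← h,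
    submatrix_id_id]

theorem toeplitzCenter_isSymm (hc : ∀ m, (c m).IsSymm) : (toeplitzCenter c N).IsSymm := by
  have h := blockToeplitz_isSymm (N := N) hc
  rw [IsSymm, toeplitzCenter, transpose_mul, transpose_mul,
    transpose_transpose, transpose_nonsing_inv, h.eq, ← Matrix.mul_assoc]
  exact transpose_mul_inv_mul_rev toeplitzCol_rev toeplitzRevCol_rev

/-- By the reversal symmetry the two diagonal blocks coincide and so do the two off-diagonal ones;
this is the (E, X; X, E) shape that splits into E ± X. -/
theorem toeplitz_schur_inner :
    fromBlocks 1 (c (N + 1)) (c (N + 1)) 1 -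
        (fromCols (toeplitzCol c N) (toeplitzRevCol c N))ᵀ * (blockToeplitz c N)⁻¹ *
          fromCols (toeplitzCol c N) (toeplitzRevCol c N) =
      fromBlocks (toeplitzSchur c N) (c (N + 1) - toeplitzCenter c N)
        (c (N + 1) - toeplitzCenter c N) (toeplitzSchur c N) := by
  have h1 : (toeplitzRevCol c N)ᵀ * (blockToeplitz c N)⁻¹ * toeplitzRevCol c N =
      (toeplitzCol c N)ᵀ * (blockToeplitz c N)⁻¹ * toeplitzCol c N :=
    transpose_mul_inv_mul_rev toeplitzCol_rev toeplitzCol_rev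
  have h2 : (toeplitzRevCol c N)ᵀ * (blockToeplitz c N)⁻¹ * toeplitzCol c N =
      (toeplitzCol c N)ᵀ * (blockToeplitz c N)⁻¹ * toeplitzRevCol c N :=
    transpose_mul_inv_mul_rev toeplitzCol_rev toeplitzRevCol_rev
  rw [transpose_fromCols, fromRows_mul, fromRows_mul_fromCols, h1, h2, sub_eq_add_neg,
    fromBlocks_neg, fromBlocks_add]
  simp only [toeplitzSchur, toeplitzCenter, sub_eq_add_neg]

theorem blockToeplitz_posDef_of_succ (h : (blockToeplitz c (N + 1)).PosDef) :
    (blockToeplitz c N).PosDef := by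
  have := h.submatrix (e := fun a : Fin N × Fin p => (a.1.succ, a.2)) (by
    rintro ⟨i, a⟩ ⟨j, b⟩ hij
    simpa using hij)
  convert this using 1
  ext ⟨i, a⟩ ⟨j, b⟩
  simp [blockToeplitz]

theorem posDef_submatrix_equiv' {m n : Type*} [Fintype m] [Fintype n] (e : m ≃ n)
    {A : Matrix n n ℝ} :
    (A.submatrix e e).PosDef ↔ A.PosDef :=
  ⟨fun h => by simpa using h.submatrix e.symm.injective, fun h => h.submatrix e.injective⟩

theorem blockToeplitz_posDef_succ_iff (hc : ∀ m, (c m).IsSymm) (h0 : c 0 = 1)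
    (h : (blockToeplitz c N).PosDef) :
    (blockToeplitz c (N + 1)).PosDef ↔ (toeplitzSchur c N).PosDef := by
  rw [← posDef_submatrix_equiv' (succBlockEquiv p N), blockToeplitz_submatrix_succ hc, h0,
    posDef_fromBlocks_iff_schur h, toeplitzSchur]

theorem det_blockToeplitz_succ (hc : ∀ m, (c m).IsSymm) (h0 : c 0 = 1)
    (h : (blockToeplitz c N).PosDef) :
    (blockToeplitz c (N + 1)).det = (blockToeplitz c N).det * (toeplitzSchur c N).det := by
  rw [← det_submatrix_equiv_self (succBlockEquiv p N), blockToeplitz_submatrix_succ hc, h0,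
    det_fromBlocks_schur h, toeplitzSchur]

/-- The newest coefficient occurs only in the two extreme corners. Eliminating the inner blocks
confines it to a matrix interval with centre `toeplitzCenter` and radius `toeplitzSchur`. -/
theorem blockToeplitz_posDef_add_two_iff (hc : ∀ m, (c m).IsSymm) (h0 : c 0 = 1)
    (h : (blockToeplitz c N).PosDef) :
    (blockToeplitz c (N + 2)).PosDef ↔
      (toeplitzSchur c N + (c (N + 1) - toeplitzCenter c N)).PosDef ∧
        (toeplitzSchur c N - (c (N + 1) - toeplitzCenter c N)).PosDef := by
  rw [← posDef_submatrix_equiv' (innerBlockEquiv p N), blockToeplitz_submatrix_inner hc h0,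
    posDef_fromBlocks_iff_schur h, toeplitz_schur_inner, posDef_fromBlocks_swap_symm]

theorem det_blockToeplitz_add_two (hc : ∀ m, (c m).IsSymm) (h0 : c 0 = 1)
    (h : (blockToeplitz c N).PosDef) :
    (blockToeplitz c (N + 2)).det = (blockToeplitz c N).det *
      ((toeplitzSchur c N + (c (N + 1) - toeplitzCenter c N)).det *
        (toeplitzSchur c N - (c (N + 1) - toeplitzCenter c N)).det) := by
  rw [← det_submatrix_equiv_self (innerBlockEquiv p N), blockToeplitz_submatrix_inner hc h0,
    det_fromBlocks_schur h, toeplitz_schur_inner, det_fromBlocks_swap_symm]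

end BlockToeplitz

/-! ### Coordinates on symmetric matrices and the Jacobian of congruence -/

section SymCoord

open Matrix

variable {p : ℕ}

/-- The symmetric matrix with entries `x_{ij}`, `i ≤ j`, as a matrix, linearly in `x`. -/
def symMatrix (p : ℕ) : (UpperIdx p → ℝ) →ₗ[ℝ] Matrix (Fin p) (Fin p) ℝ where
  toFun x := (symOfUpper p x : Matrix (Fin p) (Fin p) ℝ)
  map_add' _ _ := rfl
  map_smul' _ _ := rfl

@[simp]
theorem coe_symOfUpper (x : UpperIdx p → ℝ) :
    (symOfUpper p x : Matrix (Fin p) (Fin p) ℝ) = symMatrix p x := rfl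

theorem symMatrix_isSymm (x : UpperIdx p → ℝ) : (symMatrix p x).IsSymm := (symOfUpper p x).2

theorem symMatrix_apply (x : UpperIdx p → ℝ) (i j : Fin p) :
    symMatrix p x i j = x ⟨(min i j, max i j), min_le_max⟩ := rfl

theorem symMatrix_apply_upper (x : UpperIdx p → ℝ) (q : UpperIdx p) :
    symMatrix p x q.1.1 q.1.2 = x q := by
  rw [symMatrix_apply]
  congr 1
  exact Subtype.ext (Prod.ext (min_eq_left q.2) (max_eq_right q.2))

theorem symMatrix_upper {X : Matrix (Fin p) (Fin p) ℝ} (hX : X.IsSymm) :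
    symMatrix p (fun q => X q.1.1 q.1.2) = X := by
  ext i j
  rw [symMatrix_apply]
  rcases le_total i j with h | h
  · simp [min_eq_left h, max_eq_right h]
  · simpa [min_eq_right h, max_eq_left h] using hX.apply i j

theorem continuous_symMatrix : Continuous (symMatrix p) :=
  LinearMap.continuous_of_finiteDimensional _

/-- The map `X ↦ L X Lᵀ` in the coordinates on and above the diagonal. -/
def symCongruence (L : Matrix (Fin p) (Fin p) ℝ) : (UpperIdx p → ℝ) →ₗ[ℝ] (UpperIdx p → ℝ) where
  toFun x q := (L * symMatrix p x * Lᵀ) q.1.1 q.1.2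
  map_add' x y := by
    ext q
    simp [Matrix.mul_add, Matrix.add_mul]
  map_smul' r x := by
    ext q
    simp

theorem symMatrix_symCongruence (L : Matrix (Fin p) (Fin p) ℝ) (x : UpperIdx p → ℝ) :
    symMatrix p (symCongruence L x) = L * symMatrix p x * Lᵀ := by
  refine symMatrix_upper (X := L * symMatrix p x * Lᵀ) ?_
  rw [IsSymm, transpose_mul, transpose_mul, transpose_transpose, (symMatrix_isSymm x).eq,
    Matrix.mul_assoc]

theorem symMatrix_injective : Function.Injective (symMatrix p) := by
  intro x y h
  ext q
  rw [← symMatrix_apply_upper x, h, symMatrix_apply_upper]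

theorem symCongruence_mul (L L' : Matrix (Fin p) (Fin p) ℝ) :
    symCongruence (L * L') = symCongruence L ∘ₗ symCongruence L' := by
  refine LinearMap.ext fun x => symMatrix_injective ?_
  simp only [LinearMap.comp_apply, symMatrix_symCongruence, transpose_mul, Matrix.mul_assoc]

theorem symCongruence_one : symCongruence (1 : Matrix (Fin p) (Fin p) ℝ) = LinearMap.id := by
  refine LinearMap.ext fun x => symMatrix_injective ?_
  simp [symMatrix_symCongruence]

/-- A pair and its reflection cover the square and hit the diagonal twice. The target is a general
monoid because the identity serves both for the trace form and, through `Additive ℝ`, for a product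
of eigenvalues. -/
theorem sum_upper_add_swap {M : Type*} [AddCommMonoid M] (f : Fin p → Fin p → M) :
    ∑ q : UpperIdx p, (f q.1.1 q.1.2 + f q.1.2 q.1.1) = ∑ i, ∑ j, f i j + ∑ i, f i i := by
  have h1 : ∀ g : Fin p × Fin p → M, ∑ q : UpperIdx p, g q.1 =
      ∑ q : Fin p × Fin p with q.1 ≤ q.2, g q := fun g => by
    rw [Finset.sum_subtype (p := fun q : Fin p × Fin p => q.1 ≤ q.2) _ (by simp)]
  rw [Finset.sum_add_distrib, h1 (fun q => f q.1 q.2), h1 (fun q => f q.2 q.1)]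
  have h2 : ∑ q : Fin p × Fin p with q.1 ≤ q.2, f q.2 q.1 =
      ∑ q : Fin p × Fin p with q.2 ≤ q.1, f q.1 q.2 := by
    refine Finset.sum_equiv (Equiv.prodComm _ _) ?_ ?_ <;> simp
  have h3 : ∑ q : Fin p × Fin p with q.2 ≤ q.1, f q.1 q.2 =
      ∑ q : Fin p × Fin p with ¬ q.1 ≤ q.2, f q.1 q.2 + ∑ i, f i i := by
    have h4 : ∑ i, f i i = ∑ q : Fin p × Fin p with q.1 = q.2, f q.1 q.2 := by
      refine Finset.sum_bij (fun i _ => (i, i)) ?_ ?_ ?_ ?_ <;> simp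
    rw [h4, ← Finset.sum_union]
    · congr 1
      ext q
      simp only [Finset.mem_filter, Finset.mem_univ, true_and, Finset.mem_union,
        Fin.le_def, Fin.ext_iff]
      omega
    · rw [Finset.disjoint_filter]
      intro q _ h h'
      exact h h'.le
  rw [h2, h3, ← add_assoc, Finset.sum_filter_add_sum_filter_not, ← Fintype.sum_prod_type']

/-- The weight of an entry on or above the diagonal in the trace form. -/
def upperWeight (q : UpperIdx p) : ℝ := if q.1.1 = q.1.2 then 1 else 2

theorem one_le_upperWeight (q : UpperIdx p) : 1 ≤ upperWeight q := by
  unfold upperWeight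
  split_ifs <;> norm_num

theorem trace_symMatrix_mul (x y : UpperIdx p → ℝ) :
    (symMatrix p x * symMatrix p y).trace = ∑ q, upperWeight q * (x q * y q) := by
  have h1 : (symMatrix p x * symMatrix p y).trace =
      ∑ i, ∑ j, symMatrix p x i j * symMatrix p y i j := by
    simp only [trace, diag_apply, mul_apply]
    refine Finset.sum_congr rfl fun i _ => Finset.sum_congr rfl fun j _ => ?_
    rw [(symMatrix_isSymm y).apply]
  have h2 := sum_upper_add_swap fun i j : Fin p => symMatrix p x i j * symMatrix p y i j
  have h3 := sum_upper_add_swap fun i j : Fin p =>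
    if i = j then symMatrix p x i j * symMatrix p y i j else 0
  simp only [Finset.sum_ite_eq, Finset.mem_univ, if_true] at h3
  have h4 : ∑ q : UpperIdx p, 2 * (upperWeight q * (x q * y q)) =
      2 * ∑ i, ∑ j, symMatrix p x i j * symMatrix p y i j := by
    have h5 : ∑ q : UpperIdx p, 2 * (upperWeight q * (x q * y q)) =
        2 * ∑ q : UpperIdx p, (symMatrix p x q.1.1 q.1.2 * symMatrix p y q.1.1 q.1.2 +
          symMatrix p x q.1.2 q.1.1 * symMatrix p y q.1.2 q.1.1) -
        ∑ q : UpperIdx p, ((if q.1.1 = q.1.2 then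
            symMatrix p x q.1.1 q.1.2 * symMatrix p y q.1.1 q.1.2 else 0) +
          if q.1.2 = q.1.1 then symMatrix p x q.1.2 q.1.1 * symMatrix p y q.1.2 q.1.1 else 0) := by
      rw [Finset.mul_sum, ← Finset.sum_sub_distrib]
      refine Finset.sum_congr rfl fun q _ => ?_
      rw [(symMatrix_isSymm x).apply q.1.1 q.1.2, (symMatrix_isSymm y).apply q.1.1 q.1.2,
        symMatrix_apply_upper, symMatrix_apply_upper, upperWeight]
      by_cases h : q.1.1 = q.1.2
      · simp only [h, if_true]; ring
      · simp only [h, Ne.symm h, if_false]; ring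
    rw [h5, h2, h3]
    ring
  rw [← Finset.mul_sum] at h4
  rw [h1]
  linarith

/-- Congruences by L and by Lᵀ are adjoint for the trace form, as tr(L X Lᵀ Y) = tr(X Lᵀ Y L). The
form is nondegenerate, diagonal with entries `upperWeight`, so adjoint maps have equal determinants.
-/
theorem det_symCongruence_transpose (L : Matrix (Fin p) (Fin p) ℝ) :
    LinearMap.det (symCongruence Lᵀ) = LinearMap.det (symCongruence L) := by
  set W : Matrix (UpperIdx p) (UpperIdx p) ℝ := diagonal upperWeight
  have hW : W.det ≠ 0 := by
    rw [det_diagonal]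
    exact Finset.prod_ne_zero_iff.2 fun q _ => (zero_lt_one.trans_le (one_le_upperWeight q)).ne'
  have hform : ∀ x y : UpperIdx p → ℝ,
      (symMatrix p x * symMatrix p y).trace = x ⬝ᵥ (W *ᵥ y) := by
    intro x y
    rw [trace_symMatrix_mul, dotProduct]
    refine Finset.sum_congr rfl fun q _ => ?_
    rw [mulVec_diagonal]
    ring
  have hadj : (LinearMap.toMatrix' (symCongruence L))ᵀ * W =
      W * LinearMap.toMatrix' (symCongruence Lᵀ) := by
    refine ext_of_mulVec_single fun q => ?_
    set y : UpperIdx p → ℝ := Pi.single q 1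
    refine dotProduct_eq _ _ fun x => ?_
    rw [dotProduct_comm, dotProduct_comm _ x, ← mulVec_mulVec, ← mulVec_mulVec,
      dotProduct_mulVec, vecMul_transpose, LinearMap.toMatrix'_mulVec, LinearMap.toMatrix'_mulVec,
      ← hform, ← hform, symMatrix_symCongruence, symMatrix_symCongruence, transpose_transpose,
      Matrix.mul_assoc, Matrix.mul_assoc, trace_mul_comm]
    simp only [Matrix.mul_assoc]
  have h := congrArg det hadj
  rw [det_mul, det_mul, det_transpose, LinearMap.det_toMatrix', LinearMap.det_toMatrix',
    mul_comm] at h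
  exact (mul_left_cancel₀ hW h).symm

theorem abs_det_symCongruence_orthogonal {U : Matrix (Fin p) (Fin p) ℝ} (hU : U * Uᵀ = 1) :
    |LinearMap.det (symCongruence U)| = 1 := by
  have h := congrArg LinearMap.det (symCongruence_mul U Uᵀ)
  rw [hU, symCongruence_one, LinearMap.det_id, LinearMap.det_comp, det_symCongruence_transpose] at h
  have : |LinearMap.det (symCongruence U)| ^ 2 = 1 := by rw [sq_abs, sq, ← h]
  nlinarith [abs_nonneg (LinearMap.det (symCongruence U))]

/-- The map is diagonal in the entries, with eigenvalue d_i d_j at i ≤ j. Each d_i occurs p + 1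
times in the product because the diagonal entry counts it twice. -/
theorem det_symCongruence_diagonal (d : Fin p → ℝ) :
    LinearMap.det (symCongruence (diagonal d)) = (∏ i, d i) ^ (p + 1) := by
  have h1 : LinearMap.toMatrix' (symCongruence (diagonal d)) =
      diagonal fun q : UpperIdx p => d q.1.1 * d q.1.2 := by
    refine ext_of_mulVec_single fun q => ?_
    rw [LinearMap.toMatrix'_mulVec]
    ext r
    rw [mulVec_diagonal]
    change (diagonal d * symMatrix p (Pi.single q 1) * (diagonal d)ᵀ) r.1.1 r.1.2 = _
    rw [diagonal_transpose, mul_diagonal, diagonal_mul, symMatrix_apply_upper]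
    ring
  rw [← LinearMap.det_toMatrix', h1, det_diagonal]
  have h2 := sum_upper_add_swap (M := Additive ℝ) fun i _ : Fin p => Additive.ofMul (d i)
  simp only [← ofMul_mul, ← ofMul_prod, Finset.sum_const, Finset.card_univ, Fintype.card_fin,
    ← ofMul_pow] at h2
  have h3 := Additive.ofMul.injective h2
  rw [h3, Finset.prod_pow, pow_succ]

/-- Congruence by a square root of a positive definite matrix `E` scales volume on the symmetric
matrices by `(det E)^{(p+1)/2}`. -/
theorem exists_symCongruence_of_posDef {E : Matrix (Fin p) (Fin p) ℝ} (hE : E.PosDef) :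
    ∃ L : Matrix (Fin p) (Fin p) ℝ, L * Lᵀ = E ∧
      |LinearMap.det (symCongruence L)| = E.det ^ (((p : ℝ) + 1) / 2) := by
  set U : Matrix (Fin p) (Fin p) ℝ := hE.isHermitian.eigenvectorUnitary.1
  set d := hE.isHermitian.eigenvalues
  have hd : ∀ i, 0 < d i := hE.eigenvalues_pos
  have hU : U * Uᵀ = 1 := by
    have := (Matrix.mem_unitaryGroup_iff).1 hE.isHermitian.eigenvectorUnitary.2
    rwa [star_eq_conjTranspose, conjTranspose_eq_transpose_of_trivial] at this
  have hspec : E = U * diagonal d * Uᵀ := by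
    have := hE.isHermitian.spectral_theorem
    rw [Unitary.conjStarAlgAut_apply, star_eq_conjTranspose,
      conjTranspose_eq_transpose_of_trivial] at this
    exact this
  refine ⟨U * diagonal fun i => √(d i), ?_, ?_⟩
  · rw [transpose_mul, diagonal_transpose, Matrix.mul_assoc, ← Matrix.mul_assoc (diagonal _),
      diagonal_mul_diagonal, ← Matrix.mul_assoc, hspec]
    congr
    ext i
    exact Real.mul_self_sqrt (hd i).le
  · rw [symCongruence_mul, LinearMap.det_comp, abs_mul, abs_det_symCongruence_orthogonal hU,
      det_symCongruence_diagonal, one_mul]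
    have hdet : E.det = ∏ i, d i := by
      simpa using hE.isHermitian.det_eq_prod_eigenvalues
    have h0 : 0 ≤ ∏ i, √(d i) := Finset.prod_nonneg fun i _ => Real.sqrt_nonneg _
    have h1 : ∏ i, d i = (∏ i, √(d i)) ^ 2 := by
      rw [← Finset.prod_pow]
      exact Finset.prod_congr rfl fun i _ => (Real.sq_sqrt (hd i).le).symm
    rw [abs_of_nonneg (pow_nonneg h0 _), hdet, h1, ← Real.rpow_natCast _ 2, ← Real.rpow_mul h0,
      ← Real.rpow_natCast]
    congr 1
    push_cast
    ring

end SymCoord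

/-! ### The domain of positive block Toeplitz matrices and its marginals -/

section ToeplitzDomain

open Matrix

variable {p n : ℕ}

/-- The sequence of matrix coefficients `1, X_1, …, X_n, 0, …` of a tuple given in coordinates. -/
def coeffSeq (x : Fin n → UpperIdx p → ℝ) : ℕ → Matrix (Fin p) (Fin p) ℝ
  | 0 => 1
  | m + 1 => if h : m < n then symMatrix p (x ⟨m, h⟩) else 0

/-- The tuples whose block Toeplitz matrix is positive definite. -/
def toeplitzDomain (p n : ℕ) : Set (Fin n → UpperIdx p → ℝ) :=
  {x | (blockToeplitz (coeffSeq x) (n + 1)).PosDef}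

/-- The ratio of the last two block Toeplitz determinants of a tuple. -/
def toeplitzRatio (x : Fin n → UpperIdx p → ℝ) : ℝ :=
  (blockToeplitz (coeffSeq x) (n + 1)).det / (blockToeplitz (coeffSeq x) n).det

theorem coeffSeq_zero (x : Fin n → UpperIdx p → ℝ) : coeffSeq x 0 = 1 := rfl

theorem coeffSeq_succ (x : Fin n → UpperIdx p → ℝ) {m : ℕ} (h : m < n) :
    coeffSeq x (m + 1) = symMatrix p (x ⟨m, h⟩) := by
  simp [coeffSeq, h]

theorem coeffSeq_isSymm (x : Fin n → UpperIdx p → ℝ) (m : ℕ) : (coeffSeq x m).IsSymm := by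
  cases m with
  | zero => exact transpose_one
  | succ m =>
    simp only [coeffSeq]
    split_ifs
    · exact symMatrix_isSymm _
    · exact transpose_zero

theorem continuous_coeffSeq (m : ℕ) :
    Continuous fun x : Fin n → UpperIdx p → ℝ => coeffSeq x m := by
  cases m with
  | zero => exact continuous_const
  | succ m =>
    simp only [coeffSeq]
    split_ifs with h
    · exact continuous_symMatrix.comp (continuous_apply _)
    · exact continuous_const

theorem continuous_blockToeplitz_coeffSeq (N : ℕ) :
    Continuous fun x : Fin n → UpperIdx p → ℝ => blockToeplitz (coeffSeq x) N :=
  continuous_matrix fun a b => (continuous_coeffSeq _).matrix_elem a.2 b.2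

theorem coeffSeq_snoc_of_le (y : Fin n → UpperIdx p → ℝ) (z : UpperIdx p → ℝ) {m : ℕ}
    (hm : m ≤ n) :
    coeffSeq (Fin.snoc (α := fun _ => UpperIdx p → ℝ) y z) m = coeffSeq y m := by
  cases m with
  | zero => rfl
  | succ m =>
    rw [coeffSeq_succ _ hm, coeffSeq_succ _ (Nat.lt_succ_of_lt hm)]
    congr 1
    exact Fin.snoc_castSucc (α := fun _ => UpperIdx p → ℝ) z y ⟨m, hm⟩

theorem coeffSeq_snoc_last (y : Fin n → UpperIdx p → ℝ) (z : UpperIdx p → ℝ) :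
    coeffSeq (Fin.snoc (α := fun _ => UpperIdx p → ℝ) y z) (n + 1) = symMatrix p z := by
  rw [coeffSeq_succ _ (Nat.lt_succ_self n)]
  congr 1
  exact Fin.snoc_last (α := fun _ => UpperIdx p → ℝ) z y

theorem isClosed_setOf_blockToeplitz_posSemidef (p n N : ℕ) :
    IsClosed {x : Fin n → UpperIdx p → ℝ | (blockToeplitz (coeffSeq x) N).PosSemidef} := by
  have : {x : Fin n → UpperIdx p → ℝ | (blockToeplitz (coeffSeq x) N).PosSemidef} =
      ⋂ v, {x | 0 ≤ star v ⬝ᵥ (blockToeplitz (coeffSeq x) N *ᵥ v)} := by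
    ext x
    simp only [Set.mem_ofPred_eq, Set.mem_iInter]
    exact ⟨fun h v => h.dotProduct_mulVec_nonneg v, fun h => .of_dotProduct_mulVec_nonneg
      (by
        rw [IsHermitian, conjTranspose_eq_transpose_of_trivial]
        exact blockToeplitz_isSymm (coeffSeq_isSymm x)) h⟩
  rw [this]
  exact isClosed_iInter fun v => isClosed_le continuous_const
    (continuous_const.dotProduct ((continuous_blockToeplitz_coeffSeq N).matrix_mulVec
      continuous_const))

theorem measurableSet_toeplitzDomain (p n : ℕ) : MeasurableSet (toeplitzDomain p n) := by
  have : toeplitzDomain p n =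
      {x | (blockToeplitz (coeffSeq x) (n + 1)).PosSemidef} ∩
        {x | (blockToeplitz (coeffSeq x) (n + 1)).det ≠ 0} := by
    ext x
    have h : ∀ A : Matrix (Fin (n + 1) × Fin p) (Fin (n + 1) × Fin p) ℝ,
        A.PosDef ↔ A.PosSemidef ∧ A.det ≠ 0 := fun A =>
      ⟨fun h => ⟨h.posSemidef, h.det_pos.ne'⟩, fun h => h.1.posDef_iff_isUnit.2
        ((isUnit_iff_isUnit_det _).2 (isUnit_iff_ne_zero.2 h.2))⟩
    exact h _
  rw [this]
  refine (isClosed_setOf_blockToeplitz_posSemidef p n (n + 1)).measurableSet.inter ?_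
  exact (isOpen_ne_fun (continuous_blockToeplitz_coeffSeq _).matrix_det
    continuous_const).measurableSet

theorem measurable_toeplitzRatio : Measurable (toeplitzRatio (p := p) (n := n)) :=
  (continuous_blockToeplitz_coeffSeq _).matrix_det.measurable.div
    (continuous_blockToeplitz_coeffSeq _).matrix_det.measurable

/-- The quotient form suits measurability and the expansion at the origin; the Schur form suits the
recursive integration and the global upper bound. -/
theorem toeplitzRatio_eq {y : Fin n → UpperIdx p → ℝ} (hy : y ∈ toeplitzDomain p n) :
    toeplitzRatio y = (toeplitzSchur (coeffSeq y) n).det := by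
  have h := blockToeplitz_posDef_of_succ hy
  rw [toeplitzRatio, det_blockToeplitz_succ (coeffSeq_isSymm y) rfl h,
    mul_div_cancel_left₀ _ h.det_pos.ne']

theorem toeplitzSchur_posDef {y : Fin n → UpperIdx p → ℝ} (hy : y ∈ toeplitzDomain p n) :
    (toeplitzSchur (coeffSeq y) n).PosDef :=
  (blockToeplitz_posDef_succ_iff (coeffSeq_isSymm y) rfl (blockToeplitz_posDef_of_succ hy)).1 hy

theorem toeplitzRatio_pos {y : Fin n → UpperIdx p → ℝ} (hy : y ∈ toeplitzDomain p n) :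
    0 < toeplitzRatio y := by
  rw [toeplitzRatio_eq hy]
  exact (toeplitzSchur_posDef hy).det_pos

theorem blockToeplitz_snoc (y : Fin n → UpperIdx p → ℝ) (z : UpperIdx p → ℝ) :
    blockToeplitz (coeffSeq (Fin.snoc (α := fun _ => UpperIdx p → ℝ) y z)) (n + 1) =
      blockToeplitz (coeffSeq y) (n + 1) :=
  blockToeplitz_congr fun _ hm => coeffSeq_snoc_of_le y z (Nat.lt_succ_iff.1 hm)

theorem mem_toeplitzDomain_of_snoc {y : Fin n → UpperIdx p → ℝ} {z : UpperIdx p → ℝ}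
    (h : (Fin.snoc (α := fun _ => UpperIdx p → ℝ) y z) ∈ toeplitzDomain p (n + 1)) :
    y ∈ toeplitzDomain p n := by
  have := blockToeplitz_posDef_of_succ h
  rwa [blockToeplitz_snoc] at this

theorem snoc_mem_toeplitzDomain_iff {y : Fin n → UpperIdx p → ℝ} (hy : y ∈ toeplitzDomain p n)
    (z : UpperIdx p → ℝ) :
    (Fin.snoc (α := fun _ => UpperIdx p → ℝ) y z) ∈ toeplitzDomain p (n + 1) ↔
      (toeplitzSchur (coeffSeq y) n + (symMatrix p z - toeplitzCenter (coeffSeq y) n)).PosDef ∧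
        (toeplitzSchur (coeffSeq y) n - (symMatrix p z - toeplitzCenter (coeffSeq y) n)).PosDef := by
  set x := Fin.snoc (α := fun _ => UpperIdx p → ℝ) y z
  have hn : (blockToeplitz (coeffSeq x) n).PosDef := by
    apply blockToeplitz_posDef_of_succ
    rw [blockToeplitz_snoc]
    exact hy
  have := blockToeplitz_posDef_add_two_iff (coeffSeq_isSymm x) rfl hn
  rwa [coeffSeq_snoc_last, toeplitzSchur_congr fun m hm => coeffSeq_snoc_of_le y z hm,
    toeplitzCenter_congr fun m hm => coeffSeq_snoc_of_le y z hm] at this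

theorem toeplitzRatio_snoc {y : Fin n → UpperIdx p → ℝ} (hy : y ∈ toeplitzDomain p n)
    (z : UpperIdx p → ℝ) :
    toeplitzRatio (Fin.snoc (α := fun _ => UpperIdx p → ℝ) y z) =
      (toeplitzSchur (coeffSeq y) n + (symMatrix p z - toeplitzCenter (coeffSeq y) n)).det *
        (toeplitzSchur (coeffSeq y) n - (symMatrix p z - toeplitzCenter (coeffSeq y) n)).det /
          (toeplitzSchur (coeffSeq y) n).det := by
  set x := Fin.snoc (α := fun _ => UpperIdx p → ℝ) y z
  have hn1 : (blockToeplitz (coeffSeq x) (n + 1)).PosDef := by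
    rw [blockToeplitz_snoc]
    exact hy
  have hn := blockToeplitz_posDef_of_succ hn1
  have h1 := det_blockToeplitz_add_two (coeffSeq_isSymm x) rfl hn
  have h2 := det_blockToeplitz_succ (coeffSeq_isSymm x) rfl hn
  rw [toeplitzCenter_congr fun m hm => coeffSeq_snoc_of_le y z hm, coeffSeq_snoc_last] at h1
  rw [toeplitzSchur_congr fun m hm => coeffSeq_snoc_of_le y z hm] at h1 h2
  rw [toeplitzRatio, h1, h2, mul_div_mul_left _ _ hn.det_pos.ne']

/-- The weight `D^s` on tuples with positive definite block Toeplitz matrix, where `D` is the ratio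
of the last two block Toeplitz determinants. -/
def toeplitzWeight (s : ℝ) (x : Fin n → UpperIdx p → ℝ) : ENNReal :=
  (toeplitzDomain p n).indicator (fun x => ENNReal.ofReal (toeplitzRatio x ^ s)) x

theorem measurable_toeplitzWeight (s : ℝ) : Measurable (toeplitzWeight (p := p) (n := n) s) :=
  (measurable_toeplitzRatio.pow_const s).ennreal_ofReal.indicator
    (measurableSet_toeplitzDomain p n)

/-- The integral of `(det (1 - Z²))^s` over the symmetric matrices `-1 < Z < 1`. -/
def matrixIntervalIntegral (p : ℕ) (s : ℝ) : ENNReal :=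
  ∫⁻ z : UpperIdx p → ℝ, {z | (1 + symMatrix p z).PosDef ∧ (1 - symMatrix p z).PosDef}.indicator
    (fun z => ENNReal.ofReal (((1 + symMatrix p z).det * (1 - symMatrix p z).det) ^ s)) z

theorem lintegral_comp_symCongruence_add {L : Matrix (Fin p) (Fin p) ℝ}
    (hL : LinearMap.det (symCongruence L) ≠ 0) (m : UpperIdx p → ℝ)
    {f : (UpperIdx p → ℝ) → ENNReal} (hf : Measurable f) :
    ∫⁻ z, f z = ENNReal.ofReal |LinearMap.det (symCongruence L)| *
      ∫⁻ u, f (symCongruence L u + m) := by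
  have hcont : Continuous (symCongruence L) := LinearMap.continuous_of_finiteDimensional _
  have h1 : ∫⁻ u, f (symCongruence L u + m) =
      ENNReal.ofReal |(LinearMap.det (symCongruence L))⁻¹| * ∫⁻ z, f (z + m) := by
    rw [← smul_eq_mul, ← lintegral_smul_measure, ← Measure.map_linearMap_addHaar_eq_smul_addHaar _ hL]
    exact (lintegral_map (hf.comp (measurable_add_const m)) hcont.measurable).symm
  rw [h1, lintegral_add_right_eq_self f m, ← mul_assoc, ← ENNReal.ofReal_mul (abs_nonneg _),
    ← abs_mul, mul_inv_cancel₀ hL, abs_one, ENNReal.ofReal_one, one_mul]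

theorem measurable_snoc (y : Fin n → UpperIdx p → ℝ) :
    Measurable fun z => Fin.snoc (α := fun _ => UpperIdx p → ℝ) y z := by
  refine measurable_pi_lambda _ fun i => ?_
  induction i using Fin.lastCases with
  | last =>
    simp only [Fin.snoc_last]
    exact measurable_id
  | cast i =>
    simp only [Fin.snoc_castSucc]
    exact measurable_const

/-- The fibre over y is a matrix interval; an affine congruence maps the standard interval -1 < Z <
1 onto it. The remaining integral over Z does not depend on y, and the Jacobian raises the exponent
by (p+1)/2. -/
theorem lintegral_toeplitzWeight_snoc (s : ℝ) (y : Fin n → UpperIdx p → ℝ) :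
    ∫⁻ z, toeplitzWeight s (Fin.snoc (α := fun _ => UpperIdx p → ℝ) y z) =
      matrixIntervalIntegral p s * toeplitzWeight (s + ((p : ℝ) + 1) / 2) y := by
  by_cases hy : y ∈ toeplitzDomain p n
  swap
  · have : ∀ z, toeplitzWeight s (Fin.snoc (α := fun _ => UpperIdx p → ℝ) y z) = 0 := fun z =>
      Set.indicator_of_notMem (fun h => hy (mem_toeplitzDomain_of_snoc h)) _
    have h0 : toeplitzWeight (s + ((p : ℝ) + 1) / 2) y = 0 := Set.indicator_of_notMem hy _
    simp only [this, h0, lintegral_zero, mul_zero]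
  set E := toeplitzSchur (coeffSeq y) n
  have hE : E.PosDef := toeplitzSchur_posDef hy
  obtain ⟨L, hLE, hLdet⟩ := exists_symCongruence_of_posDef hE
  have hdet0 : LinearMap.det (symCongruence L) ≠ 0 := by
    rw [← abs_pos, hLdet]
    exact Real.rpow_pos_of_pos hE.det_pos _
  set m : UpperIdx p → ℝ := fun q => toeplitzCenter (coeffSeq y) n q.1.1 q.1.2
  have hm : symMatrix p m = toeplitzCenter (coeffSeq y) n :=
    symMatrix_upper (toeplitzCenter_isSymm (coeffSeq_isSymm y))
  have hLu : IsUnit L := by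
    rw [isUnit_iff_isUnit_det, isUnit_iff_ne_zero]
    intro h
    have := hE.det_pos
    rw [← hLE, det_mul, h, zero_mul] at this
    exact lt_irrefl _ this
  have hLP : ∀ X : Matrix (Fin p) (Fin p) ℝ, (L * X * Lᵀ).PosDef ↔ X.PosDef := fun X => by
    rw [← conjTranspose_eq_transpose_of_trivial, ← star_eq_conjTranspose]
    exact hLu.posDef_star_right_conjugate_iff
  have hLdet2 : ∀ X : Matrix (Fin p) (Fin p) ℝ, (L * X * Lᵀ).det = E.det * X.det := fun X => by
    rw [← hLE, det_mul, det_mul, det_mul]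
    ring
  have hadd : ∀ u, E + (symMatrix p (symCongruence L u + m) - toeplitzCenter (coeffSeq y) n) =
      L * (1 + symMatrix p u) * Lᵀ := fun u => by
    rw [map_add, hm, add_sub_cancel_right, symMatrix_symCongruence, Matrix.mul_add, Matrix.add_mul,
      Matrix.mul_one, hLE]
  have hsub : ∀ u, E - (symMatrix p (symCongruence L u + m) - toeplitzCenter (coeffSeq y) n) =
      L * (1 - symMatrix p u) * Lᵀ := fun u => by
    rw [map_add, hm, add_sub_cancel_right, symMatrix_symCongruence, Matrix.mul_sub, Matrix.sub_mul,
      Matrix.mul_one, hLE]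
  have hmeas : Measurable fun z : UpperIdx p → ℝ =>
      toeplitzWeight s (Fin.snoc (α := fun _ => UpperIdx p → ℝ) y z) :=
    (measurable_toeplitzWeight s).comp (measurable_snoc y)
  rw [lintegral_comp_symCongruence_add hdet0 m hmeas]
  -- The new ratio is (det E)² det(1+Z) det(1-Z) / det E, so exactly one factor det E is left to be
  -- raised to the power s.
  have hpt : ∀ u, toeplitzWeight s
      (Fin.snoc (α := fun _ => UpperIdx p → ℝ) y (symCongruence L u + m)) =
      ENNReal.ofReal (E.det ^ s) *
        {z | (1 + symMatrix p z).PosDef ∧ (1 - symMatrix p z).PosDef}.indicator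
        (fun z => ENNReal.ofReal (((1 + symMatrix p z).det * (1 - symMatrix p z).det) ^ s)) u := by
    intro u
    have hiff := snoc_mem_toeplitzDomain_iff hy (symCongruence L u + m)
    rw [hadd, hsub, hLP, hLP] at hiff
    by_cases hu : (1 + symMatrix p u).PosDef ∧ (1 - symMatrix p u).PosDef
    · rw [toeplitzWeight, Set.indicator_of_mem (hiff.2 hu), Set.indicator_of_mem (by exact hu),
        toeplitzRatio_snoc hy, hadd, hsub, hLdet2, hLdet2,
        ← ENNReal.ofReal_mul (Real.rpow_nonneg hE.det_pos.le _),
        ← Real.mul_rpow hE.det_pos.le (mul_pos hu.1.det_pos hu.2.det_pos).le]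
      congr 2
      rw [mul_mul_mul_comm, mul_assoc, mul_div_cancel_left₀ _ hE.det_pos.ne']
    · rw [toeplitzWeight, Set.indicator_of_notMem (fun h => hu (hiff.1 h)),
        Set.indicator_of_notMem (by exact hu), mul_zero]
  simp_rw [hpt]
  rw [lintegral_const_mul' _ _ ENNReal.ofReal_ne_top, ← mul_assoc,
    ← ENNReal.ofReal_mul (abs_nonneg _), mul_comm, ← matrixIntervalIntegral, toeplitzWeight,
    Set.indicator_of_mem hy, hLdet, toeplitzRatio_eq hy, ← Real.rpow_add hE.det_pos, add_comm s]

theorem lintegral_toeplitzWeight_succ (s : ℝ) {ψ : (Fin n → UpperIdx p → ℝ) → ENNReal}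
    (hψ : Measurable ψ) :
    ∫⁻ x : Fin (n + 1) → UpperIdx p → ℝ, ψ (fun i => x i.castSucc) * toeplitzWeight s x =
      matrixIntervalIntegral p s * ∫⁻ y, ψ y * toeplitzWeight (s + ((p : ℝ) + 1) / 2) y := by
  set e := MeasurableEquiv.piFinSuccAbove (fun _ : Fin (n + 1) => UpperIdx p → ℝ) (Fin.last n)
  have he := volume_preserving_piFinSuccAbove (fun _ : Fin (n + 1) => UpperIdx p → ℝ) (Fin.last n)
  have hsymm : ∀ z y, e.symm (z, y) = Fin.snoc (α := fun _ => UpperIdx p → ℝ) y z := fun z y => by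
    simp [e, MeasurableEquiv.piFinSuccAbove_symm_apply, Fin.insertNthEquiv]
  have hmeas : Measurable fun x : Fin (n + 1) → UpperIdx p → ℝ =>
      ψ (fun i => x i.castSucc) * toeplitzWeight s x :=
    (hψ.comp (measurable_pi_lambda _ fun i => measurable_pi_apply _)).mul
      (measurable_toeplitzWeight s)
  rw [← he.symm.lintegral_comp_emb e.symm.measurableEmbedding, Measure.volume_eq_prod,
    lintegral_prod_symm' _ (by exact hmeas.comp e.symm.measurable)]
  refine Eq.trans ?_ (lintegral_const_mul _ (hψ.mul (measurable_toeplitzWeight _)))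
  refine lintegral_congr fun y => ?_
  simp only [e] at hsymm
  simp only [hsymm, Fin.snoc_castSucc]
  refine (lintegral_const_mul _ ((measurable_toeplitzWeight s).comp (measurable_snoc y))).trans ?_
  simp only [Function.comp_apply]
  rw [lintegral_toeplitzWeight_snoc]
  ring

/-- The marginal of the weighted Lebesgue measure on the first coordinates. -/
theorem exists_lintegral_toeplitzWeight (k d : ℕ) (s : ℝ) :
    ∃ c : ENNReal, ∀ ψ : (Fin k → UpperIdx p → ℝ) → ENNReal, Measurable ψ →
      ∫⁻ x : Fin (k + d) → UpperIdx p → ℝ, ψ (fun i => x (Fin.castAdd d i)) * toeplitzWeight s x =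
        c * ∫⁻ y, ψ y * toeplitzWeight (s + d * (((p : ℝ) + 1) / 2)) y := by
  induction d generalizing s with
  | zero =>
    refine ⟨1, fun ψ _ => ?_⟩
    have : s + ((0 : ℕ) : ℝ) * (((p : ℝ) + 1) / 2) = s := by simp
    rw [one_mul, this]
    rfl
  | succ d ih =>
    -- The last variable is integrated out first, which raises the exponent seen by the remaining d
    -- variables.
    obtain ⟨c, hc⟩ := ih (s + ((p : ℝ) + 1) / 2)
    refine ⟨matrixIntervalIntegral p s * c, fun ψ hψ => ?_⟩
    have h := lintegral_toeplitzWeight_succ (n := k + d) s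
      (ψ := fun x => ψ fun i => x (Fin.castAdd d i))
      (hψ.comp (measurable_pi_lambda _ fun i => measurable_pi_apply _))
    rw [hc ψ hψ] at h
    rw [mul_assoc]
    push_cast
    rw [show s + (d + 1) * (((p : ℝ) + 1) / 2) =
      s + ((p : ℝ) + 1) / 2 + d * (((p : ℝ) + 1) / 2) by ring]
    exact h

end ToeplitzDomain

/-! ### Powers in the Chebyshev basis and arcsine moments -/

section ChebyshevExpansion

open Polynomial.Chebyshev

theorem two_mul_cos_pow (N : ℕ) (φ : ℝ) :
    (2 * Real.cos φ) ^ N =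
      ∑ l ∈ Finset.range (N + 1), (N.choose l : ℝ) * Real.cos ((2 * l - N) * φ) := by
  have h : ((2 * Real.cos φ : ℝ) : ℂ) ^ N =
      ∑ l ∈ Finset.range (N + 1), (N.choose l : ℂ) * Complex.exp (((2 * l - N) * φ : ℝ) * Complex.I) := by
    have h2 : ((2 * Real.cos φ : ℝ) : ℂ) =
        Complex.exp (φ * Complex.I) + Complex.exp (-φ * Complex.I) := by
      push_cast
      exact Complex.two_cos φ
    rw [h2, add_pow]
    refine Finset.sum_congr rfl fun l hl => ?_
    have hl' : l ≤ N := Nat.lt_succ_iff.1 (Finset.mem_range.1 hl)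
    rw [← Complex.exp_nat_mul, ← Complex.exp_nat_mul, ← Complex.exp_add, mul_comm]
    congr 2
    push_cast [Nat.cast_sub hl']
    ring
  have h3 := congrArg Complex.re h
  rw [← Complex.ofReal_pow, Complex.ofReal_re, Complex.re_sum] at h3
  rw [h3]
  refine Finset.sum_congr rfl fun l _ => ?_
  rw [← Complex.ofReal_natCast, Complex.re_ofReal_mul, Complex.exp_ofReal_mul_I_re]

/-- The left side is (2 cos(θ/2))^(2i). In its binomial expansion the terms of opposite frequency
pair up, which gives the factor 2 and leaves the central coefficient alone. -/
theorem two_add_two_cos_pow (i : ℕ) (θ : ℝ) :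
    (2 + 2 * Real.cos θ) ^ i = ((2 * i).choose i : ℝ) +
      2 * ∑ j ∈ Finset.range i, ((2 * i).choose (i - (j + 1)) : ℝ) * Real.cos ((j + 1) * θ) := by
  have h0 : 2 + 2 * Real.cos θ = (2 * Real.cos (θ / 2)) ^ 2 := by
    rw [mul_pow, Real.cos_sq]
    ring_nf
  rw [h0, ← pow_mul, two_mul_cos_pow, show 2 * i + 1 = i + (1 + i) by ring, Finset.sum_range_add,
    Finset.sum_range_add, Finset.sum_range_one, ← Finset.sum_range_reflect]
  have h1 : ∑ j ∈ Finset.range i, ((2 * i).choose (i - 1 - j) : ℝ) *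
      Real.cos ((2 * ((i - 1 - j : ℕ) : ℝ) - ((2 * i : ℕ) : ℝ)) * (θ / 2)) =
      ∑ j ∈ Finset.range i, ((2 * i).choose (i - (j + 1)) : ℝ) * Real.cos ((j + 1) * θ) := by
    refine Finset.sum_congr rfl fun j hj => ?_
    have hj' : j + 1 ≤ i := Finset.mem_range.1 hj
    rw [Nat.sub_sub, add_comm 1 j, Nat.cast_sub hj', ← Real.cos_neg]
    congr 2
    push_cast
    ring
  have h2 : ∑ j ∈ Finset.range i, ((2 * i).choose (i + (1 + j)) : ℝ) *
      Real.cos ((2 * ((i + (1 + j) : ℕ) : ℝ) - ((2 * i : ℕ) : ℝ)) * (θ / 2)) =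
      ∑ j ∈ Finset.range i, ((2 * i).choose (i - (j + 1)) : ℝ) * Real.cos ((j + 1) * θ) := by
    refine Finset.sum_congr rfl fun j hj => ?_
    have hj' : j + 1 ≤ i := Finset.mem_range.1 hj
    rw [← Nat.choose_symm (show i + (1 + j) ≤ 2 * i by omega),
      show 2 * i - (i + (1 + j)) = i - (j + 1) by omega]
    congr 2
    push_cast
    ring
  rw [h1, h2]
  have h3 : Real.cos ((2 * ((i + 0 : ℕ) : ℝ) - ((2 * i : ℕ) : ℝ)) * (θ / 2)) = 1 := by
    rw [← Real.cos_zero]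
    congr 1
    push_cast
    ring
  rw [h3, add_zero]
  ring

/-- The expansion of a power in Chebyshev polynomials on `[0, 1]`. -/
theorem pow_eq_sum_chebyshev (i : ℕ) {y : ℝ} (h0 : 0 ≤ y) (h1 : y ≤ 1) :
    y ^ i = (4 ^ i)⁻¹ * ((2 * i).choose i + 2 * ∑ j ∈ Finset.range i,
      ((2 * i).choose (i - (j + 1)) : ℝ) * (T ℝ ((j + 1 : ℕ) : ℤ)).eval (2 * y - 1)) := by
  obtain ⟨θ, hθ⟩ : ∃ θ, Real.cos θ = 2 * y - 1 :=
    ⟨Real.arccos (2 * y - 1), Real.cos_arccos (by linarith) (by linarith)⟩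
  have h := two_add_two_cos_pow i θ
  simp only [← hθ, T_real_cos]
  push_cast
  rw [← h, hθ, show 2 + 2 * (2 * y - 1) = 4 * y by ring, mul_pow, inv_mul_cancel_left₀ (by positivity)]

theorem integral_cos_succ_mul (j : ℕ) : ∫ θ in (0 : ℝ)..Real.pi, Real.cos ((j + 1) * θ) = 0 := by
  have h := integral_eval_T_real_measureT_of_ne_zero (n := ((j + 1 : ℕ) : ℤ)) (by positivity)
  rw [integral_measureT_eq_integral_cos] at h
  simp only [T_real_cos] at h
  push_cast at h
  exact h

/-- Under x = (1 + cos θ)/2 the arcsine law becomes uniform in θ on [0, π], so only the constant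
term of the cosine expansion survives. -/
theorem arcsineMoment_eq (i : ℕ) : arcsineMoment i = (4 ^ i)⁻¹ * ((2 * i).choose i : ℝ) := by
  have h1 : arcsineMoment i = 2⁻¹ * ∫ z in (-1 : ℝ)..1,
      ((z + 1) / 2) ^ i / (Real.pi * √((z + 1) / 2 * (1 - (z + 1) / 2))) := by
    have := intervalIntegral.integral_comp_mul_add (a := -1) (b := 1)
      (fun x : ℝ => x ^ i / (Real.pi * √(x * (1 - x)))) (c := 2⁻¹) (by norm_num) 2⁻¹
    rw [show (2 : ℝ)⁻¹ * -1 + 2⁻¹ = 0 by norm_num, show (2 : ℝ)⁻¹ * 1 + 2⁻¹ = 1 by norm_num] at this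
    rw [arcsineMoment]
    have h2 : ∀ z : ℝ, (z + 1) / 2 = 2⁻¹ * z + 2⁻¹ := fun z => by ring
    simp only [h2]
    rw [this, smul_eq_mul]
    ring
  have h2 : ∀ z : ℝ, ((z + 1) / 2) ^ i / (Real.pi * √((z + 1) / 2 * (1 - (z + 1) / 2))) =
      2 / Real.pi * (((z + 1) / 2) ^ i * √(1 - z ^ 2)⁻¹) := fun z => by
    rw [show (z + 1) / 2 * (1 - (z + 1) / 2) = (1 - z ^ 2) / 2 ^ 2 by ring,
      Real.sqrt_div' _ (by positivity), Real.sqrt_sq (by norm_num), Real.sqrt_inv]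
    field_simp
  rw [h1]
  simp only [h2]
  rw [intervalIntegral.integral_const_mul, ← integral_measureT, integral_measureT_eq_integral_cos]
  have h3 : ∀ θ : ℝ, ((Real.cos θ + 1) / 2) ^ i = (4 ^ i)⁻¹ * (((2 * i).choose i : ℝ) +
      2 * ∑ j ∈ Finset.range i,
        ((2 * i).choose (i - (j + 1)) : ℝ) * Real.cos ((j + 1) * θ)) := fun θ => by
    rw [← two_add_two_cos_pow, ← inv_pow, ← mul_pow]
    congr 1
    ring
  simp only [h3]
  have hint : ∀ j : ℕ, IntervalIntegrable (fun θ : ℝ => ((2 * i).choose (i - (j + 1)) : ℝ) *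
      Real.cos ((j + 1) * θ)) volume 0 Real.pi := fun j =>
    (by fun_prop : Continuous fun θ : ℝ => ((2 * i).choose (i - (j + 1)) : ℝ) *
      Real.cos ((j + 1) * θ)).intervalIntegrable _ _
  rw [intervalIntegral.integral_const_mul, intervalIntegral.integral_add
    intervalIntegrable_const (Continuous.intervalIntegrable (by fun_prop) _ _),
    intervalIntegral.integral_const_mul, intervalIntegral.integral_finsetSum fun j _ => hint j]
  simp only [intervalIntegral.integral_const_mul, integral_cos_succ_mul, mul_zero,
    Finset.sum_const_zero, add_zero, intervalIntegral.integral_const, sub_zero, smul_eq_mul]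
  have := Real.pi_ne_zero
  field_simp

theorem coeffMatrix_apply_of_le {k : ℕ} {i j : Fin k} (h : j ≤ i) :
    coeffMatrix k i j = 2 * (2 * ((4 ^ ((i : ℕ) + 1))⁻¹ *
      ((2 * ((i : ℕ) + 1)).choose ((i : ℕ) + 1 - ((j : ℕ) + 1)) : ℝ))) := by
  have h4 : (2 : ℝ) ^ (-2 * (((i : ℕ) : ℤ) + 1) + 2) = 2 * (2 * (4 ^ ((i : ℕ) + 1))⁻¹) := by
    rw [zpow_add₀ two_ne_zero, zpow_mul, show (2 : ℝ) ^ (-2 : ℤ) = 4⁻¹ by norm_num, inv_zpow,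
      ← Nat.cast_one, ← Nat.cast_add, zpow_natCast]
    norm_num
    ring
  rw [coeffMatrix, Matrix.of_apply, if_pos h, h4]
  ring

/-- The expansion of a power in Chebyshev polynomials on `[0, 1]`, with the coefficients of the
asymptotic statement. -/
theorem pow_succ_eq_arcsineMoment_add {k : ℕ} (i : Fin k) {y : ℝ} (h0 : 0 ≤ y) (h1 : y ≤ 1) :
    y ^ ((i : ℕ) + 1) = arcsineMoment ((i : ℕ) + 1) +
      ∑ j : Fin k, 2⁻¹ * coeffMatrix k i j * (T ℝ (((j : ℕ) + 1 : ℕ) : ℤ)).eval (2 * y - 1) := by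
  rw [pow_eq_sum_chebyshev _ h0 h1, arcsineMoment_eq, mul_add, ← mul_assoc _ 2, Finset.mul_sum]
  congr 1
  rw [Finset.sum_fin_eq_sum_range]
  have hsub : Finset.range ((i : ℕ) + 1) ⊆ Finset.range k := by
    intro j hj
    simp only [Finset.mem_range] at hj ⊢
    omega
  rw [← Finset.sum_subset hsub]
  · refine Finset.sum_congr rfl fun j hj => ?_
    have hj' := Finset.mem_range.1 hj
    have hjk : j < k := Finset.mem_range.1 (hsub hj)
    rw [dif_pos hjk, coeffMatrix_apply_of_le (Fin.le_def.2 (Nat.lt_succ_iff.1 hj'))]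
    simp only
    ring
  · intro j hj hj'
    have hjk : j < k := Finset.mem_range.1 hj
    have hji : ¬ (⟨j, hjk⟩ : Fin k) ≤ i := by
      rw [Fin.le_def]
      simpa using hj'
    rw [dif_pos hjk, coeffMatrix, Matrix.of_apply, if_neg hji]
    ring

theorem det_coeffMatrix_ne_zero (k : ℕ) : (coeffMatrix k).det ≠ 0 := by
  rw [Matrix.det_of_isLowerTriangular]
  · refine Finset.prod_ne_zero_iff.2 fun i _ => ?_
    rw [coeffMatrix_apply_of_le le_rfl]
    simp
  · intro i j hij
    rw [coeffMatrix, Matrix.of_apply, if_neg (not_le.2 (by simpa using hij))]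

end ChebyshevExpansion

/-! ### The truncated trigonometric matrix moment problem -/

section ToeplitzMoment

open Polynomial Polynomial.Chebyshev Matrix

/-- Two families with the same inner products are related by a linear isometry. -/
theorem exists_linearIsometry_of_inner_eq {H ι : Type*} [NormedAddCommGroup H]
    [InnerProductSpace ℝ H] [FiniteDimensional ℝ H] [Fintype ι] (f g : ι → H)
    (h : ∀ i j, inner ℝ (f i) (f j) = inner ℝ (g i) (g j)) :
    ∃ L : H →ₗᵢ[ℝ] H, ∀ i, L (f i) = g i := by
  classical
  set F := Fintype.linearCombination ℝ f
  set G := Fintype.linearCombination ℝ g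
  have hnorm : ∀ x, ‖G x‖ = ‖F x‖ := by
    intro x
    have : inner ℝ (G x) (G x) = inner ℝ (F x) (F x) := by
      simp only [F, G, Fintype.linearCombination_apply, sum_inner, inner_sum, inner_smul_left,
        inner_smul_right, h]
    rw [real_inner_self_eq_norm_sq, real_inner_self_eq_norm_sq] at this
    exact (sq_eq_sq₀ (norm_nonneg _) (norm_nonneg _)).1 this
  -- Any linear section of F will do: by `hnorm` the kernel of F is killed by G, so G ∘ σ sends F x
  -- to G x.
  obtain ⟨σ, hσ⟩ := F.rangeRestrict.exists_rightInverse_of_surjective F.range_rangeRestrict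
  have hσ' : ∀ s : LinearMap.range F, F (σ s) = s := fun s =>
    congrArg Subtype.val (LinearMap.congr_fun hσ s)
  let L : LinearMap.range F →ₗᵢ[ℝ] H :=
    { toLinearMap := G ∘ₗ σ
      norm_map' := fun s => by
        rw [LinearMap.comp_apply, hnorm, hσ']
        rfl }
  refine ⟨L.extend, fun i => ?_⟩
  have hf : F (Pi.single i 1) = f i := by simp [F]
  have hg : G (Pi.single i 1) = g i := by simp [G]
  have hmem : f i ∈ LinearMap.range F := ⟨_, hf⟩
  have h1 := L.extend_apply ⟨f i, hmem⟩
  rw [h1]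
  change G (σ ⟨f i, hmem⟩) = g i
  rw [← hg, ← sub_eq_zero, ← map_sub, ← norm_eq_zero, hnorm, map_sub, hσ', hf, sub_self, norm_zero]

/-- The operator version of T_m(cos θ) = cos mθ: for inverse elements A, B, the sums A^m + B^m
satisfy the Chebyshev recurrence with A + B in the role of 2x. -/
theorem two_smul_aeval_chebyshev {R : Type*} [Ring R] [Algebra ℝ R] {A B : R} (hAB : A * B = 1)
    (hBA : B * A = 1) (m : ℕ) :
    (2 : ℝ) • aeval ((2⁻¹ : ℝ) • (A + B)) (T ℝ (m : ℤ)) = A ^ m + B ^ m := by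
  induction m using Nat.twoStepInduction with
  | zero => simp [two_smul]
  | one => simp [smul_smul]
  | more m h0 h1 =>
    have h2 : ((m + 2 : ℕ) : ℤ) = (m : ℤ) + 2 := by push_cast; ring
    have h3 : ((m + 1 : ℕ) : ℤ) = (m : ℤ) + 1 := by push_cast; ring
    rw [h3] at h1
    have hmul : aeval ((2⁻¹ : ℝ) • (A + B)) (2 * X : ℝ[X]) = A + B := by
      rw [map_mul, aeval_X, map_ofNat, mul_smul_comm, two_mul, ← two_smul ℝ (A + B), smul_smul]
      norm_num
    have e1 : A * B ^ (m + 1) = B ^ m := by rw [pow_succ', ← mul_assoc, hAB, one_mul]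
    have e2 : B * A ^ (m + 1) = A ^ m := by rw [pow_succ', ← mul_assoc, hBA, one_mul]
    rw [h2, T_add_two, map_sub, smul_sub, h0, map_mul, hmul, ← mul_smul_comm, h1, add_mul, mul_add,
      mul_add, e1, e2, ← pow_succ', ← pow_succ']
    abel

theorem exists_gram_eq {m : Type} [Fintype m] [DecidableEq m] {A : Matrix m m ℝ}
    (hA : A.PosSemidef) : ∃ (H : Type) (_ : NormedAddCommGroup H) (_ : InnerProductSpace ℝ H)
      (_ : FiniteDimensional ℝ H) (g : m → H), ∀ i j, inner ℝ (g i) (g j) = A i j := by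
  open scoped MatrixOrder in
  obtain ⟨B, hB⟩ := CStarAlgebra.nonneg_iff_eq_star_mul_self.1 hA.nonneg
  refine ⟨EuclideanSpace ℝ m, inferInstance, inferInstance, inferInstance,
    fun i => WithLp.toLp 2 fun l => B l i, fun i j => ?_⟩
  rw [hB, PiLp.inner_apply, star_eq_conjTranspose, mul_apply]
  simp [mul_comm]

variable {p n : ℕ}

/-- The truncated trigonometric moment problem for symmetric matrices: a positive semidefinite
block Toeplitz matrix consists of Chebyshev moments of a discrete matrix measure. -/
theorem exists_chebyshev_moments_of_blockToeplitz {c : ℕ → Matrix (Fin p) (Fin p) ℝ}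
    (hc : ∀ m, (c m).IsSymm) (h : (blockToeplitz c (n + 1)).PosSemidef) :
    ∃ (N : ℕ) (t : Fin N → ℝ) (w : Fin N → Fin p → ℝ), (∀ l, |t l| ≤ 1) ∧
      ∀ m ≤ n, ∀ a b, c m a b = ∑ l, (T ℝ (m : ℤ)).eval (t l) * (w l a * w l b) := by
  obtain ⟨H, _, _, _, g, hg⟩ := exists_gram_eq h
  -- The Toeplitz structure says that shifting the block index preserves inner products of the Gram
  -- vectors. The shift thus extends to an isometry, which is surjective by finite dimension.
  obtain ⟨L, hL⟩ := exists_linearIsometry_of_inner_eq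
    (fun a : Fin n × Fin p => g (a.1.castSucc, a.2)) (fun a => g (a.1.succ, a.2)) (fun a b => by
      rw [hg, hg]
      simp [blockToeplitz])
  set U : H ≃ₗᵢ[ℝ] H := L.toLinearIsometryEquiv rfl
  have hU : ∀ x, U x = L x := fun x => rfl
  set A : Module.End ℝ H := U.toLinearEquiv.toLinearMap
  set B : Module.End ℝ H := U.symm.toLinearEquiv.toLinearMap
  have hA : ∀ x, A x = U x := fun _ => rfl
  have hB : ∀ x, B x = U.symm x := fun _ => rfl
  have hAB : A * B = 1 := LinearMap.ext fun x => U.apply_symm_apply x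
  have hBA : B * A = 1 := LinearMap.ext fun x => U.symm_apply_apply x
  have hadj : ∀ x y, inner ℝ (A x) y = inner ℝ x (B y) := fun x y => by
    rw [hA, hB, ← U.inner_map_map x, U.apply_symm_apply]
  -- The self-adjoint operator playing the role of cos θ; being an average of two isometries it has
  -- norm at most 1, so its spectrum lies in [-1, 1].
  set W : Module.End ℝ H := (2⁻¹ : ℝ) • (A + B)
  have hW : W.IsSymmetric := fun x y => by
    simp only [W, LinearMap.smul_apply, LinearMap.add_apply, inner_smul_left, inner_smul_right,
      inner_add_left, inner_add_right, hadj]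
    rw [real_inner_comm (A y) x, hadj y x, real_inner_comm y (B x), add_comm]
    rfl
  have hpow : ∀ (m : ℕ) (hm : m < n + 1) (b : Fin p), (A ^ m) (g (0, b)) = g (⟨m, hm⟩, b) := by
    intro m
    induction m with
    | zero => intro _ b; rfl
    | succ m ih =>
      intro hm b
      rw [pow_succ', Module.End.mul_apply, ih (by omega) b, hA, hU]
      exact hL (⟨m, by omega⟩, b)
  have hadjpow : ∀ (m : ℕ) (x y : H), inner ℝ x ((B ^ m) y) = inner ℝ ((A ^ m) x) y := by
    intro m
    induction m with
    | zero => intro x y; rfl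
    | succ m ih =>
      intro x y
      rw [pow_succ', Module.End.mul_apply, ← hadj, ih, pow_succ, Module.End.mul_apply]
  have hAm : ∀ m ≤ n, ∀ a b, inner ℝ (g (0, a)) ((A ^ m) (g (0, b))) = c m a b := by
    intro m hm a b
    rw [hpow m (by omega), hg]
    simp [blockToeplitz]
  -- The inverse shift yields the transposed coefficients. Their symmetry is what makes the average
  -- of both directions reproduce c m.
  have hBm : ∀ m ≤ n, ∀ a b, inner ℝ (g (0, a)) ((B ^ m) (g (0, b))) = c m a b := by
    intro m hm a b
    rw [hadjpow, real_inner_comm, hAm m hm, (hc m).apply]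
  have hTm : ∀ m ≤ n, ∀ a b, inner ℝ (g (0, a)) (aeval W (T ℝ (m : ℤ)) (g (0, b))) = c m a b := by
    intro m hm a b
    have h1 := congrArg (fun F : Module.End ℝ H => inner ℝ (g (0, a)) (F (g (0, b))))
      (two_smul_aeval_chebyshev hAB hBA m)
    simp only [LinearMap.smul_apply, LinearMap.add_apply, inner_smul_right, inner_add_right,
      hAm m hm, hBm m hm] at h1
    change 2 * inner ℝ (g (0, a)) (aeval W (T ℝ (m : ℤ)) (g (0, b))) = _ at h1
    linarith
  set u := hW.eigenvectorBasis (n := Module.finrank ℝ H) rfl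
  set t := hW.eigenvalues (n := Module.finrank ℝ H) rfl
  have hu : ∀ l, W (u l) = t l • u l := fun l => hW.apply_eigenvectorBasis rfl l
  -- The nodes are the eigenvalues of W and the weights are the eigenbasis coordinates of the first
  -- block of Gram vectors.
  refine ⟨Module.finrank ℝ H, t, fun l a => inner ℝ (g (0, a)) (u l), fun l => ?_, ?_⟩
  · have h1 : ‖W (u l)‖ ≤ 1 := by
      have h2 : ‖A (u l) + B (u l)‖ ≤ 2 := by
        refine (norm_add_le _ _).trans ?_
        rw [hA, hB, U.norm_map, U.symm.norm_map, u.orthonormal.1 l]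
        norm_num
      rw [LinearMap.smul_apply, norm_smul, LinearMap.add_apply]
      norm_num
      linarith
    rwa [hu, norm_smul, u.orthonormal.1 l, mul_one] at h1
  · intro m hm a b
    have hW' : ∀ l, aeval W (T ℝ (m : ℤ)) (u l) = (T ℝ (m : ℤ)).eval (t l) • u l := fun l =>
      Module.End.aeval_apply_of_hasEigenvector
        ⟨Module.End.mem_eigenspace_iff.2 (hu l), u.orthonormal.ne_zero l⟩
    rw [← hTm m hm a b]
    conv_lhs => rw [← u.sum_repr' (g (0, b)), map_sum, inner_sum]
    refine Finset.sum_congr rfl fun l _ => ?_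
    rw [map_smul, hW', inner_smul_right, inner_smul_right, real_inner_comm (g (0, b))]
    ring

end ToeplitzMoment

/-! ### The moment space as an affine image of nonnegative Toeplitz tuples -/

section MomentSpace

open Polynomial.Chebyshev Matrix

open scoped Topology

instance isFiniteMeasure_variation_signedMeasure {X : Type*} [MeasurableSpace X]
    (μ : SignedMeasure X) : IsFiniteMeasure μ.variation := by
  rw [← SignedMeasure.totalVariation_eq_variation]
  infer_instance

theorem integrable_signedMeasure_of_continuous {X : Type*} [TopologicalSpace X] [CompactSpace X]
    [MeasurableSpace X] [BorelSpace X] [SecondCountableTopology X] (μ : SignedMeasure X) {f : X → ℝ}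
    (hf : Continuous f) : μ.Integrable f :=
  hf.integrable_of_hasCompactSupport (HasCompactSupport.of_compactSpace f)

/-- The Chebyshev polynomials shifted to `[0, 1]`. -/
def shiftedChebyshev (m : ℕ) (x : ℝ) : ℝ := (T ℝ (m : ℤ)).eval (2 * x - 1)

theorem continuous_shiftedChebyshev (m : ℕ) : Continuous (shiftedChebyshev m) :=
  (T ℝ (m : ℤ)).continuous.comp (by fun_prop)

theorem integral_pow_succ_eq {k : ℕ} (μ : SignedMeasure (Set.Icc (0 : ℝ) 1)) (i : Fin k) :
    ∫ᵛ x, (x : ℝ) ^ ((i : ℕ) + 1) ∂<•μ = arcsineMoment ((i : ℕ) + 1) * μ Set.univ +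
      ∑ j : Fin k, 2⁻¹ * coeffMatrix k i j * ∫ᵛ x, shiftedChebyshev ((j : ℕ) + 1) x ∂<•μ := by
  have h : (fun x : Set.Icc (0 : ℝ) 1 => (x : ℝ) ^ ((i : ℕ) + 1)) = fun x : Set.Icc (0 : ℝ) 1 =>
      arcsineMoment ((i : ℕ) + 1) + ∑ j : Fin k, (2⁻¹ * coeffMatrix k i j) •
        shiftedChebyshev ((j : ℕ) + 1) (x : ℝ) := by
    ext x
    exact pow_succ_eq_arcsineMoment_add i x.2.1 x.2.2
  have hint : ∀ j : Fin k, μ.Integrable fun x : Set.Icc (0 : ℝ) 1 =>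
      (2⁻¹ * coeffMatrix k i j) • shiftedChebyshev ((j : ℕ) + 1) (x : ℝ) := fun j => by
    have hc := (continuous_shiftedChebyshev ((j : ℕ) + 1)).comp
      (continuous_subtype_val (p := fun x : ℝ => x ∈ Set.Icc (0 : ℝ) 1))
    refine integrable_signedMeasure_of_continuous μ ?_
    exact hc.const_smul (2⁻¹ * coeffMatrix k i j)
  rw [h, VectorMeasure.integral_fun_add (integrable_signedMeasure_of_continuous μ continuous_const)
    (VectorMeasure.Integrable.fun_finsetSum _ fun j _ => hint j),
    VectorMeasure.integral_finsetSum _ fun j _ => hint j, VectorMeasure.integral_const]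
  simp only [VectorMeasure.integral_fun_smul]
  congr 1
  exact mul_comm _ _

variable {p n : ℕ}

/-- The moments of a matrix measure with respect to the shifted Chebyshev polynomials. -/
def MatrixMeasure.chebyshevMoment (μ : MatrixMeasure p) (m : ℕ) : Matrix (Fin p) (Fin p) ℝ :=
  Matrix.of fun i j => ∫ᵛ x, shiftedChebyshev m x ∂<•(μ.entry i j)

theorem MatrixMeasure.entry_symm (μ : MatrixMeasure p) (i j : Fin p) :
    μ.entry i j = μ.entry j i := by
  refine VectorMeasure.ext fun B hB => ?_
  have := (μ.posSemidef B hB).isHermitian.apply j i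
  simpa using this

theorem MatrixMeasure.chebyshevMoment_isSymm (μ : MatrixMeasure p) (m : ℕ) :
    (μ.chebyshevMoment m).IsSymm := by
  ext i j
  simp only [chebyshevMoment, transpose_apply, of_apply]
  rw [μ.entry_symm]

theorem MatrixMeasure.chebyshevMoment_zero (μ : MatrixMeasure p) : μ.chebyshevMoment 0 = 1 := by
  rw [← μ.normalized]
  ext i j
  simp [chebyshevMoment, shiftedChebyshev]

theorem MatrixMeasure.moment_succ_eq (μ : MatrixMeasure p) {k : ℕ} (i : Fin k) :
    μ.moment ((i : ℕ) + 1) = arcsineMoment ((i : ℕ) + 1) • (1 : Matrix (Fin p) (Fin p) ℝ) +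
      ∑ j : Fin k, (2⁻¹ * coeffMatrix k i j) • μ.chebyshevMoment ((j : ℕ) + 1) := by
  rw [← μ.normalized]
  ext a b
  simp only [moment, chebyshevMoment, of_apply, integral_pow_succ_eq, Matrix.add_apply, Matrix.smul_apply,
    Matrix.sum_apply, smul_eq_mul]

/-- Continuous functions on `[0, 1]` are integrated by limits of Riemann sums, with the same
partitions for all signed measures. -/
theorem exists_simpleFunc_tendsto_integral :
    ∃ φ : ℕ → SimpleFunc (Set.Icc (0 : ℝ) 1) (Set.Icc (0 : ℝ) 1),
      ∀ (μ : SignedMeasure (Set.Icc (0 : ℝ) 1)) (f : Set.Icc (0 : ℝ) 1 → ℝ), Continuous f →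
        Tendsto (fun N => ∑ y ∈ (φ N).range, f y * μ (φ N ⁻¹' {y})) atTop
          (𝓝 (∫ᵛ x, f x ∂<•μ)) := by
  -- Approximating the identity of [0,1], rather than f, makes the partitions independent of f and
  -- μ, so one sequence serves all matrix entries.
  refine ⟨SimpleFunc.approxOn id measurable_id Set.univ ⟨0, by simp⟩ (Set.mem_univ _),
    fun μ f hf => ?_⟩
  set φ := SimpleFunc.approxOn (id : Set.Icc (0 : ℝ) 1 → Set.Icc (0 : ℝ) 1) measurable_id Set.univ
    ⟨0, by simp⟩ (Set.mem_univ _)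
  have hφ : ∀ x, Tendsto (fun N => φ N x) atTop (𝓝 x) := fun x =>
    SimpleFunc.tendsto_approxOn measurable_id (Set.mem_univ _) (by simp)
  obtain ⟨C, hC⟩ := isCompact_univ.exists_bound_of_continuousOn hf.continuousOn
  have hlim : Tendsto (fun N => ∫ᵛ x, f (φ N x) ∂<•μ) atTop (𝓝 (∫ᵛ x, f x ∂<•μ)) := by
    refine VectorMeasure.tendsto_integral_filter_of_norm_le_const ?_ ⟨C, ?_⟩ ?_
    · exact Eventually.of_forall fun N =>
        (hf.measurable.comp (φ N).measurable).aestronglyMeasurable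
    · exact Eventually.of_forall fun N => Eventually.of_forall fun x => hC _ (Set.mem_univ _)
    · exact Eventually.of_forall fun x => (hf.tendsto x).comp (hφ x)
  refine hlim.congr fun N => ?_
  have h1 : (fun x => f (φ N x)) = fun x => ∑ y ∈ (φ N).range,
      (φ N ⁻¹' {y}).indicator (fun _ => f y) x := by
    ext x
    rw [Finset.sum_eq_single (φ N x)]
    · simp
    · intro y _ hy
      exact Set.indicator_of_notMem (fun h => hy (by simpa using h.symm)) _
    · intro h
      exact absurd (SimpleFunc.mem_range_self _ x) h
  have hms : ∀ y, MeasurableSet (φ N ⁻¹' {y}) := fun y => (φ N).measurableSet_fiber y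
  rw [h1, VectorMeasure.integral_finsetSum]
  · refine Finset.sum_congr rfl fun y _ => ?_
    rw [VectorMeasure.integral_indicator_const _ (hms y)]
    simp [mul_comm]
  · intro y _
    exact (integrable_const (f y)).indicator (hms y)

/-- This is the contribution of a point mass A. The addition formula for cos((i-j)θ) writes the
scalar Toeplitz matrix as a sum of two rank-one squares, and a Kronecker product of nonnegative
matrices is nonnegative. -/
theorem posSemidef_cos_kronecker (θ : ℝ) (N : ℕ) {A : Matrix (Fin p) (Fin p) ℝ}
    (hA : A.PosSemidef) :
    (blockToeplitz (fun m => Real.cos (m * θ) • A) N).PosSemidef := by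
  set u : Fin N → ℝ := fun i => Real.cos (i * θ)
  set v : Fin N → ℝ := fun i => Real.sin (i * θ)
  have h : blockToeplitz (fun m => Real.cos (m * θ) • A) N =
      kronecker (vecMulVec u (star u) + vecMulVec v (star v)) A := by
    ext ⟨i, a⟩ ⟨j, b⟩
    have hcos : Real.cos ((((i : ℤ) - j).natAbs : ℝ) * θ) =
        Real.cos (i * θ) * Real.cos (j * θ) + Real.sin (i * θ) * Real.sin (j * θ) := by
      rw [← Real.cos_sub, ← sub_mul, Nat.cast_natAbs]
      push_cast
      rcases abs_choice ((i : ℝ) - j) with h | h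
      · rw [h]
      · rw [h, neg_mul, Real.cos_neg]
    simp only [blockToeplitz, of_apply, Matrix.smul_apply, smul_eq_mul, kronecker, kroneckerMap_apply,
      Matrix.add_apply, vecMulVec_apply, star_trivial, u, v]
    rw [hcos]
  rw [h]
  exact ((posSemidef_vecMulVec_self_star u).add (posSemidef_vecMulVec_self_star v)).kronecker hA

theorem posSemidef_of_tendsto {m : Type*} [Fintype m] {A : ℕ → Matrix m m ℝ} {B : Matrix m m ℝ}
    (hA : ∀ N, (A N).PosSemidef) (h : ∀ i j, Tendsto (fun N => A N i j) atTop (𝓝 (B i j))) :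
    B.PosSemidef := by
  have h' : Tendsto A atTop (𝓝 B) := tendsto_pi_nhds.2 fun i => tendsto_pi_nhds.2 fun j => h i j
  refine .of_dotProduct_mulVec_nonneg ?_ fun v => ?_
  · ext i j
    refine tendsto_nhds_unique (h j i) ((h i j).congr fun N => ?_)
    exact (hA N).isHermitian.apply j i
  · have hc : Continuous fun M : Matrix m m ℝ => star v ⬝ᵥ (M *ᵥ v) :=
      continuous_const.dotProduct (continuous_id.matrix_mulVec continuous_const)
    exact ge_of_tendsto' ((hc.tendsto B).comp h') fun N => (hA N).dotProduct_mulVec_nonneg v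

/-- A Riemann sum over a partition replaces μ by point masses μ(B) ≥ 0, for which positivity is
explicit; it survives the entrywise limit. -/
theorem MatrixMeasure.blockToeplitz_chebyshevMoment_posSemidef (μ : MatrixMeasure p) (N : ℕ) :
    (blockToeplitz μ.chebyshevMoment N).PosSemidef := by
  obtain ⟨φ, hφ⟩ := exists_simpleFunc_tendsto_integral
  refine posSemidef_of_tendsto (A := fun M => ∑ y ∈ (φ M).range,
    blockToeplitz (fun m => shiftedChebyshev m y •
      Matrix.of fun a b => μ.entry a b (φ M ⁻¹' {y})) N) (fun M => ?_) fun i j => ?_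
  · refine posSemidef_sum _ fun y _ => ?_
    have hy : Real.cos (Real.arccos (2 * (y : ℝ) - 1)) = 2 * (y : ℝ) - 1 :=
      Real.cos_arccos (by linarith [y.2.1]) (by linarith [y.2.2])
    have := posSemidef_cos_kronecker (Real.arccos (2 * (y : ℝ) - 1)) N
      (μ.posSemidef _ ((φ M).measurableSet_fiber y))
    convert this using 4 with m
    rw [shiftedChebyshev, ← hy, T_real_cos, hy]
    simp
  · have := hφ (μ.entry i.2 j.2) (fun x => shiftedChebyshev ((i.1 : ℤ) - j.1).natAbs x)
      ((continuous_shiftedChebyshev _).comp continuous_subtype_val)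
    simpa only [blockToeplitz, chebyshevMoment, of_apply, Matrix.sum_apply, Matrix.smul_apply,
      smul_eq_mul] using this

/-- The matrix measure with masses `w w^T` at finitely many points. -/
def discreteMatrixMeasure {N : ℕ} (t : Fin N → Set.Icc (0 : ℝ) 1) (w : Fin N → Fin p → ℝ)
    (hw : ∀ a b, ∑ l, w l a * w l b = (1 : Matrix (Fin p) (Fin p) ℝ) a b) : MatrixMeasure p where
  entry a b := ∑ l, VectorMeasure.dirac (t l) (w l a * w l b)
  posSemidef B hB := by
    classical
    have : (Matrix.of fun a b =>
        (∑ l, VectorMeasure.dirac (t l) (w l a * w l b) : SignedMeasure (Set.Icc (0 : ℝ) 1)) B) =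
        ∑ l, if t l ∈ B then vecMulVec (w l) (star (w l)) else 0 := by
      ext a b
      rw [of_apply, FunLike.coe_sum, Finset.sum_apply, Matrix.sum_apply]
      refine Finset.sum_congr rfl fun l _ => ?_
      split_ifs with h
      · simp [h, hB, vecMulVec_apply]
      · simp [h]
    rw [this]
    refine posSemidef_sum _ fun l _ => ?_
    split_ifs
    · exact posSemidef_vecMulVec_self_star _
    · exact .zero
  normalized := by
    ext a b
    rw [of_apply, ← hw a b, FunLike.coe_sum, Finset.sum_apply]
    simp

theorem discreteMatrixMeasure_chebyshevMoment {N : ℕ} (t : Fin N → Set.Icc (0 : ℝ) 1)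
    (w : Fin N → Fin p → ℝ)
    (hw : ∀ a b, ∑ l, w l a * w l b = (1 : Matrix (Fin p) (Fin p) ℝ) a b) (m : ℕ) (a b : Fin p) :
    (discreteMatrixMeasure t w hw).chebyshevMoment m a b =
      ∑ l, shiftedChebyshev m (t l) * (w l a * w l b) := by
  rw [MatrixMeasure.chebyshevMoment, of_apply, discreteMatrixMeasure,
    VectorMeasure.integral_finsetSum_vectorMeasure]
  · refine Finset.sum_congr rfl fun l _ => ?_
    rw [VectorMeasure.integral_dirac]
    simp [mul_comm]
  · intro l _
    exact integrable_signedMeasure_of_continuous _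
      ((continuous_shiftedChebyshev _).comp continuous_subtype_val)

/-- The affine parametrization of the moments by the Chebyshev moments. -/
def momentParam (p n : ℕ) (x : Fin n → UpperIdx p → ℝ) : Fin n → SymMat p :=
  arcsineCenter p n + (2⁻¹ : ℝ) • kronAct (coeffMatrix n) fun i => symOfUpper p (x i)

theorem coe_momentParam (x : Fin n → UpperIdx p → ℝ) (i : Fin n) :
    (momentParam p n x i : Matrix (Fin p) (Fin p) ℝ) =
      arcsineMoment ((i : ℕ) + 1) • (1 : Matrix (Fin p) (Fin p) ℝ) +
        ∑ j : Fin n, (2⁻¹ * coeffMatrix n i j) • symMatrix p (x j) := by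
  simp only [momentParam, arcsineCenter, kronAct, Pi.add_apply, Pi.smul_apply, Submodule.coe_add,
    Submodule.coe_smul, Submodule.coe_sum, coe_symOfUpper, Finset.smul_sum, smul_smul]

/-- The moment space is the affine image of the set of tuples with positive semidefinite block
Toeplitz matrix. -/
theorem momentSpace_eq_image (p n : ℕ) : momentSpace p n = momentParam p n ''
    {x | (blockToeplitz (coeffSeq x) (n + 1)).PosSemidef} := by
  ext S
  constructor
  · rintro ⟨μ, hμ⟩
    set x : Fin n → UpperIdx p → ℝ := fun i q => μ.chebyshevMoment ((i : ℕ) + 1) q.1.1 q.1.2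
    have hx : ∀ i, symMatrix p (x i) = μ.chebyshevMoment ((i : ℕ) + 1) := fun i =>
      symMatrix_upper (μ.chebyshevMoment_isSymm _)
    refine ⟨x, ?_, ?_⟩
    · have h : ∀ m < n + 1, coeffSeq x m = μ.chebyshevMoment m := by
        rintro (_ | m) hm
        · exact μ.chebyshevMoment_zero.symm
        · rw [coeffSeq_succ x (by omega), hx]
      rw [Set.mem_ofPred_eq, blockToeplitz_congr h]
      exact μ.blockToeplitz_chebyshevMoment_posSemidef _
    · ext1 i
      apply Subtype.ext
      rw [hμ, coe_momentParam, μ.moment_succ_eq]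
      simp only [hx]
  · rintro ⟨x, hx, rfl⟩
    obtain ⟨N, t, w, ht, hw⟩ := exists_chebyshev_moments_of_blockToeplitz (coeffSeq_isSymm x) hx
    have hw0 : ∀ a b, ∑ l, w l a * w l b = (1 : Matrix (Fin p) (Fin p) ℝ) a b := fun a b => by
      have := hw 0 (Nat.zero_le _) a b
      rw [coeffSeq_zero] at this
      rw [this]
      simp
    set μ := discreteMatrixMeasure (fun l => ⟨(t l + 1) / 2, by
      linarith [(abs_le.1 (ht l)).1], by linarith [(abs_le.1 (ht l)).2]⟩) w hw0
    have hμ : ∀ m ≤ n, μ.chebyshevMoment m = coeffSeq x m := fun m hm => by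
      ext a b
      rw [discreteMatrixMeasure_chebyshevMoment, hw m hm]
      refine Finset.sum_congr rfl fun l _ => ?_
      rw [shiftedChebyshev]
      congr 2
      ring
    refine ⟨μ, fun i => ?_⟩
    rw [coe_momentParam, μ.moment_succ_eq]
    congr 1
    refine Finset.sum_congr rfl fun j _ => ?_
    rw [hμ _ j.2, coeffSeq_succ x j.2]

end MomentSpace

/-! ### Expansion of the weight at the origin and Gaussian domination -/

section Asymptotics

open Matrix

open scoped Topology

theorem smul_one_add_smul_eq_conj {m : Type*} [Fintype m] [DecidableEq m] {A : Matrix m m ℝ}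
    (hA : A.IsHermitian) (c ε : ℝ) :
    c • (1 : Matrix m m ℝ) + ε • A = hA.eigenvectorUnitary.1 *
      diagonal (fun i => c + ε * hA.eigenvalues i) * (star hA.eigenvectorUnitary.1) := by
  have h1 : diagonal (fun i => c + ε * hA.eigenvalues i) =
      c • (1 : Matrix m m ℝ) + ε • diagonal hA.eigenvalues := by
    rw [smul_one_eq_diagonal, ← diagonal_smul, diagonal_add]
    rfl
  have h2 : A = hA.eigenvectorUnitary.1 * diagonal hA.eigenvalues *
      star hA.eigenvectorUnitary.1 := by
    have := hA.spectral_theorem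
    rwa [Unitary.conjStarAlgAut_apply] at this
  have h3 : hA.eigenvectorUnitary.1 * star hA.eigenvectorUnitary.1 = 1 :=
    Matrix.mem_unitaryGroup_iff.1 hA.eigenvectorUnitary.2
  rw [h1, Matrix.mul_add, Matrix.add_mul, Matrix.mul_smul, Matrix.smul_mul, Matrix.mul_one, h3,
    Matrix.mul_smul, Matrix.smul_mul, ← h2]

theorem det_one_add_smul_eq_prod {m : Type*} [Fintype m] [DecidableEq m] {A : Matrix m m ℝ}
    (hA : A.IsHermitian) (ε : ℝ) :
    (1 + ε • A).det = ∏ i, (1 + ε * hA.eigenvalues i) := by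
  have h := smul_one_add_smul_eq_conj hA 1 ε
  have h3 : hA.eigenvectorUnitary.1 * star hA.eigenvectorUnitary.1 = 1 :=
    Matrix.mem_unitaryGroup_iff.1 hA.eigenvectorUnitary.2
  rw [one_smul] at h
  rw [h, det_mul, det_mul, det_diagonal, mul_right_comm, ← det_mul, h3, det_one, one_mul]

theorem posDef_one_add_smul {m : Type*} [Fintype m] [DecidableEq m] {A : Matrix m m ℝ}
    (hA : A.IsHermitian) {ε : ℝ} (h : ∀ i, 0 < 1 + ε * hA.eigenvalues i) :
    (1 + ε • A).PosDef := by
  have h1 := smul_one_add_smul_eq_conj hA 1 ε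
  rw [one_smul] at h1
  rw [h1, (Unitary.isUnit_coe (U := hA.eigenvectorUnitary)).posDef_star_right_conjugate_iff]
  exact .diagonal h

theorem posSemidef_smul_one_sub {m : Type*} [Fintype m] [DecidableEq m] {A : Matrix m m ℝ}
    (hA : A.PosSemidef) {c : ℝ} (hc : A.trace ≤ c) : (c • (1 : Matrix m m ℝ) - A).PosSemidef := by
  have h1 := smul_one_add_smul_eq_conj hA.isHermitian c (-1)
  rw [neg_one_smul, ← sub_eq_add_neg] at h1
  rw [h1, star_eq_conjTranspose]
  refine (PosSemidef.diagonal fun i => ?_).mul_mul_conjTranspose_same _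
  have h2 : hA.isHermitian.eigenvalues i ≤ A.trace := by
    rw [hA.isHermitian.trace_eq_sum_eigenvalues]
    exact Finset.single_le_sum (f := hA.isHermitian.eigenvalues)
      (fun j _ => hA.eigenvalues_nonneg j) (Finset.mem_univ i)
  simp only [Pi.zero_apply]
  linarith

theorem trace_sq_eq_sum_eigenvalues_sq {m : Type*} [Fintype m] [DecidableEq m] {A : Matrix m m ℝ}
    (hA : A.IsHermitian) : (A ^ 2).trace = ∑ i, hA.eigenvalues i ^ 2 := by
  have h := smul_one_add_smul_eq_conj hA 0 1
  rw [zero_smul, zero_add, one_smul] at h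
  simp only [zero_add, one_mul] at h
  have h3 : star hA.eigenvectorUnitary.1 * hA.eigenvectorUnitary.1 = 1 :=
    Matrix.mem_unitaryGroup_iff'.1 hA.eigenvectorUnitary.2
  have h4 : A ^ 2 = hA.eigenvectorUnitary.1 * (diagonal hA.eigenvalues *
      diagonal hA.eigenvalues) * star hA.eigenvectorUnitary.1 := by
    refine (sq A).trans ((congrArg₂ (· * ·) h h).trans ?_)
    simp only [Matrix.mul_assoc]
    rw [← Matrix.mul_assoc (star _) _ (diagonal _ * _), h3, Matrix.one_mul]
  rw [h4, trace_mul_comm, ← Matrix.mul_assoc, h3, Matrix.one_mul, diagonal_mul_diagonal,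
    trace_diagonal]
  exact Finset.sum_congr rfl fun i _ => (sq _).symm

/-- Once |εa| < 1/2 the remainder of the logarithm after two terms is at most 2|εa|³, which is O(ε)
after division by ε². -/
theorem tendsto_log_one_add_sub_div_sq (a : ℝ) :
    Tendsto (fun ε : ℝ => (Real.log (1 + ε * a) - ε * a) / ε ^ 2) (𝓝[≠] 0) (𝓝 (-a ^ 2 / 2)) := by
  have hlim : Tendsto (fun ε : ℝ => |ε| * |a| ^ 3 * 2) (𝓝[≠] 0) (𝓝 0) := by
    have : Continuous fun ε : ℝ => |ε| * |a| ^ 3 * 2 := by fun_prop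
    simpa using (this.tendsto 0).mono_left nhdsWithin_le_nhds
  rw [tendsto_iff_norm_sub_tendsto_zero]
  have hsmall : ∀ᶠ ε : ℝ in 𝓝[≠] 0, |ε * a| < 1 / 2 := by
    have : Continuous fun ε : ℝ => |ε * a| := by fun_prop
    have h := (this.tendsto 0).mono_left (nhdsWithin_le_nhds (s := {0}ᶜ))
    simp only [zero_mul, abs_zero] at h
    exact h.eventually_lt_const (by norm_num)
  refine squeeze_zero' (Eventually.of_forall fun _ => norm_nonneg _) ?_ hlim
  filter_upwards [hsmall, self_mem_nhdsWithin] with ε hε hε0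
  have hε0' : ε ≠ 0 := hε0
  have h1 := Real.abs_log_sub_add_sum_range_le (x := -(ε * a)) (by rw [abs_neg]; linarith) 2
  rw [abs_neg, sub_neg_eq_add] at h1
  have h2 : (Real.log (1 + ε * a) - ε * a) / ε ^ 2 - -a ^ 2 / 2 =
      (∑ i ∈ Finset.range 2, (-(ε * a)) ^ (i + 1) / (↑i + 1) + Real.log (1 + ε * a)) / ε ^ 2 := by
    rw [Finset.sum_range_succ, Finset.sum_range_one]
    push_cast
    field_simp
    ring
  rw [h2, Real.norm_eq_abs, abs_div, abs_of_pos (pow_pos (abs_pos.2 hε0') 2 |>.trans_eq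
    (sq_abs ε)), div_le_iff₀ (by positivity)]
  refine h1.trans ?_
  rw [div_le_iff₀ (by linarith), abs_mul, mul_pow, ← sq_abs ε]
  have : |ε| * |a| < 1 / 2 := by rwa [← abs_mul]
  have h5 : 0 ≤ |ε| ^ 3 * |a| ^ 3 := by positivity
  have h6 : |ε| ^ 3 * |a| ^ 3 * (|ε| * |a|) ≤ |ε| ^ 3 * |a| ^ 3 * (1 / 2) :=
    mul_le_mul_of_nonneg_left this.le h5
  generalize |ε| = e at h6 ⊢
  generalize |a| = b at h6 ⊢
  linear_combination 2 * h6

/-- Summing the scalar expansion over the eigenvalues, the first-order terms add up to the trace and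
vanish. -/
theorem tendsto_log_det_one_add_smul {m : Type*} [Fintype m] [DecidableEq m] {A : Matrix m m ℝ}
    (hA : A.IsHermitian) (htr : A.trace = 0) :
    Tendsto (fun ε : ℝ => Real.log (1 + ε • A).det / ε ^ 2) (𝓝[≠] 0)
      (𝓝 (-(A ^ 2).trace / 2)) := by
  have h1 : Tendsto (fun ε : ℝ => ∑ i, (Real.log (1 + ε * hA.eigenvalues i) -
      ε * hA.eigenvalues i) / ε ^ 2) (𝓝[≠] 0) (𝓝 (∑ i, -hA.eigenvalues i ^ 2 / 2)) :=
    tendsto_finsetSum _ fun i _ => tendsto_log_one_add_sub_div_sq _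
  have h2 : ∑ i, -hA.eigenvalues i ^ 2 / 2 = -(A ^ 2).trace / 2 := by
    rw [trace_sq_eq_sum_eigenvalues_sq hA, ← Finset.sum_div, Finset.sum_neg_distrib]
  rw [h2] at h1
  refine h1.congr' ?_
  have hpos : ∀ i, ∀ᶠ ε : ℝ in 𝓝[≠] 0, 0 < 1 + ε * hA.eigenvalues i := fun i => by
    have : Continuous fun ε : ℝ => 1 + ε * hA.eigenvalues i := by fun_prop
    have h := (this.tendsto 0).mono_left (nhdsWithin_le_nhds (s := {0}ᶜ))
    simp only [zero_mul, add_zero] at h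
    exact h.eventually_const_lt (by norm_num)
  filter_upwards [eventually_all.2 hpos] with ε hε
  rw [← Finset.sum_div, Finset.sum_sub_distrib, ← Finset.mul_sum]
  have h3 : ∑ i, hA.eigenvalues i = 0 := by
    rw [← htr, hA.trace_eq_sum_eigenvalues]
    rfl
  rw [h3, mul_zero, sub_zero, det_one_add_smul_eq_prod hA,
    Real.log_prod fun i _ => (hε i).ne']

theorem eventually_posDef_one_add_smul {m : Type*} [Fintype m] [DecidableEq m] {A : Matrix m m ℝ}
    (hA : A.IsHermitian) : ∀ᶠ ε : ℝ in 𝓝[≠] 0, (1 + ε • A).PosDef := by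
  have hpos : ∀ i, ∀ᶠ ε : ℝ in 𝓝[≠] 0, 0 < 1 + ε * hA.eigenvalues i := fun i => by
    have : Continuous fun ε : ℝ => 1 + ε * hA.eigenvalues i := by fun_prop
    have h := (this.tendsto 0).mono_left (nhdsWithin_le_nhds (s := {0}ᶜ))
    simp only [zero_mul, add_zero] at h
    exact h.eventually_const_lt (by norm_num)
  filter_upwards [eventually_all.2 hpos] with ε hε using posDef_one_add_smul hA hε

variable {p k : ℕ}

/-- The coefficient sequence with its initial identity matrix removed. -/
def hollowSeq (y : Fin k → UpperIdx p → ℝ) (m : ℕ) : Matrix (Fin p) (Fin p) ℝ :=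
  if m = 0 then 0 else coeffSeq y m

theorem hollowSeq_isSymm (y : Fin k → UpperIdx p → ℝ) (m : ℕ) : (hollowSeq y m).IsSymm := by
  unfold hollowSeq
  split_ifs
  · exact transpose_zero
  · exact coeffSeq_isSymm y m

theorem blockToeplitz_coeffSeq_smul (y : Fin k → UpperIdx p → ℝ) (ε : ℝ) (N : ℕ) :
    blockToeplitz (coeffSeq (ε • y)) N = 1 + ε • blockToeplitz (hollowSeq y) N := by
  have h : ∀ m, coeffSeq (ε • y) m = (if m = 0 then 1 else 0) + ε • hollowSeq y m := by
    rintro (_ | m)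
    · simp [coeffSeq_zero, hollowSeq]
    · simp only [hollowSeq, coeffSeq, Nat.add_one_ne_zero, if_false, zero_add]
      split_ifs <;> simp
  ext ⟨i, a⟩ ⟨j, b⟩
  simp only [blockToeplitz, of_apply, h, Matrix.add_apply, Matrix.smul_apply]
  congr 1
  by_cases hij : i = j
  · subst hij
    by_cases hab : a = b
    · subst hab; simp
    · simp [one_apply, hab]
  · have : ((i : ℤ) - j).natAbs ≠ 0 := by
      have := Fin.val_ne_of_ne hij
      omega
    rw [if_neg this, one_apply_ne (by simp [hij])]
    rfl

theorem trace_blockToeplitz (c : ℕ → Matrix (Fin p) (Fin p) ℝ) (N : ℕ) :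
    (blockToeplitz c N).trace = N * (c 0).trace := by
  simp [trace, blockToeplitz, Fintype.sum_prod_type]

theorem trace_transpose_toeplitzCol_mul {c : ℕ → Matrix (Fin p) (Fin p) ℝ}
    (hc : ∀ m, (c m).IsSymm) (N : ℕ) :
    ((toeplitzCol c N)ᵀ * toeplitzCol c N).trace = ∑ i : Fin N, (c ((i : ℕ) + 1) ^ 2).trace := by
  simp only [trace, diag_apply, mul_apply, transpose_apply, toeplitzCol, of_apply,
    Fintype.sum_prod_type, sq]
  rw [Finset.sum_comm]
  refine Finset.sum_congr rfl fun i _ => Finset.sum_congr rfl fun a _ =>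
    Finset.sum_congr rfl fun b _ => ?_
  rw [(hc _).apply]

theorem trace_blockToeplitz_sq_succ {c : ℕ → Matrix (Fin p) (Fin p) ℝ}
    (hc : ∀ m, (c m).IsSymm) (h0 : c 0 = 0) (N : ℕ) :
    (blockToeplitz c (N + 1) ^ 2).trace =
      (blockToeplitz c N ^ 2).trace + 2 * ∑ i : Fin N, (c ((i : ℕ) + 1) ^ 2).trace := by
  have h1 : (blockToeplitz c (N + 1) ^ 2).trace =
      ((blockToeplitz c (N + 1) ^ 2).submatrix (succBlockEquiv p N) (succBlockEquiv p N)).trace := by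
    simp only [trace, diag_apply, submatrix_apply]
    exact ((succBlockEquiv p N).sum_comp fun a => (blockToeplitz c (N + 1) ^ 2) a a).symm
  have h2 : ∀ (A : Matrix (Fin N × Fin p) (Fin N × Fin p) ℝ) (B : Matrix (Fin N × Fin p) (Fin p) ℝ)
      (C : Matrix (Fin p) (Fin N × Fin p) ℝ) (D : Matrix (Fin p) (Fin p) ℝ),
      (fromBlocks A B C D).trace = A.trace + D.trace := fun A B C D => by
    simp [trace, Fintype.sum_sum_type]
  rw [h1, sq, ← submatrix_mul_equiv _ _ _ (succBlockEquiv p N), blockToeplitz_submatrix_succ hc, h0,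
    fromBlocks_multiply, h2, trace_add, trace_add, trace_mul_comm (toeplitzCol c N),
    trace_transpose_toeplitzCol_mul hc, sq]
  simp
  ring

/-- The exponent of the limiting density: the sum of the traces of the squared blocks. -/
def traceSq (y : Fin k → UpperIdx p → ℝ) : ℝ := ∑ i, (symMatrix p (y i) ^ 2).trace

/-- log D is a difference of two log-determinants near the identity. Their quadratic terms differ by
the new border alone, whose row and column contribute equally; this 2 cancels the 1/2 of the
expansion. -/
theorem tendsto_log_toeplitzRatio (y : Fin k → UpperIdx p → ℝ) :
    Tendsto (fun ε : ℝ => Real.log (toeplitzRatio (ε • y)) / ε ^ 2) (𝓝[≠] 0) (𝓝 (-traceSq y)) := by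
  have hH : ∀ N, (blockToeplitz (hollowSeq y) N).IsHermitian := fun N => by
    rw [IsHermitian, conjTranspose_eq_transpose_of_trivial]
    exact blockToeplitz_isSymm (hollowSeq_isSymm y)
  have htr : ∀ N, (blockToeplitz (hollowSeq y) N).trace = 0 := fun N => by
    rw [trace_blockToeplitz]
    simp [hollowSeq]
  have h := (tendsto_log_det_one_add_smul (hH (k + 1)) (htr _)).sub
    (tendsto_log_det_one_add_smul (hH k) (htr _))
  have hlim : -(blockToeplitz (hollowSeq y) (k + 1) ^ 2).trace / 2 -
      -(blockToeplitz (hollowSeq y) k ^ 2).trace / 2 = -traceSq y := by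
    rw [trace_blockToeplitz_sq_succ (hollowSeq_isSymm y) rfl, traceSq]
    have : ∀ i : Fin k, hollowSeq y ((i : ℕ) + 1) = symMatrix p (y i) := fun i => by
      rw [hollowSeq, if_neg (Nat.succ_ne_zero _), coeffSeq_succ y i.2]
    simp only [this]
    ring
  rw [hlim] at h
  refine h.congr' ?_
  filter_upwards [eventually_posDef_one_add_smul (hH (k + 1)),
    eventually_posDef_one_add_smul (hH k)] with ε h1 h2
  rw [← sub_div, toeplitzRatio, blockToeplitz_coeffSeq_smul, blockToeplitz_coeffSeq_smul,
    Real.log_div h1.det_pos.ne' h2.det_pos.ne']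

/-- Written as exp((s ε²) · (log D(εy) / ε²)), the weight depends on s and ε in the limit only
through s ε² → 1/2. Each fixed y lies in the domain after scaling by small ε. -/
theorem tendsto_toeplitzWeight {ι : Type*} {l : Filter ι} {s ε : ι → ℝ}
    (hε : Tendsto ε l (𝓝[≠] 0)) (hs : Tendsto (fun i => s i * ε i ^ 2) l (𝓝 (1 / 2)))
    (y : Fin k → UpperIdx p → ℝ) :
    Tendsto (fun i => toeplitzWeight (s i) (ε i • y)) l
      (𝓝 (ENNReal.ofReal (Real.exp (-(1 / 2) * traceSq y)))) := by
  have h1 := hs.mul ((tendsto_log_toeplitzRatio y).comp hε)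
  rw [show 1 / 2 * -traceSq y = -(1 / 2) * traceSq y by ring] at h1
  refine (ENNReal.tendsto_ofReal ((Real.continuous_exp.tendsto _).comp h1)).congr' ?_
  have hH : (blockToeplitz (hollowSeq y) (k + 1)).IsHermitian := by
    rw [IsHermitian, conjTranspose_eq_transpose_of_trivial]
    exact blockToeplitz_isSymm (hollowSeq_isSymm y)
  filter_upwards [hε.eventually (eventually_posDef_one_add_smul hH),
    hε.eventually self_mem_nhdsWithin] with i hi hi0
  have hi0' : ε i ≠ 0 := hi0
  have hmem : ε i • y ∈ toeplitzDomain p k := by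
    rw [toeplitzDomain, Set.mem_ofPred_eq, blockToeplitz_coeffSeq_smul]
    exact hi
  rw [toeplitzWeight, Set.indicator_of_mem hmem, Real.rpow_def_of_pos (toeplitzRatio_pos hmem)]
  simp only [Function.comp_apply]
  congr 2
  field_simp

/-- Apply λ ≤ exp(λ - 1) to each eigenvalue. -/
theorem det_le_exp_trace_sub_one {m : Type*} [Fintype m] [DecidableEq m] {E : Matrix m m ℝ}
    (hE : E.PosSemidef) : E.det ≤ Real.exp (E - 1).trace := by
  have h1 : (E - 1).trace = ∑ i, (hE.isHermitian.eigenvalues i - 1) := by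
    rw [trace_sub, hE.isHermitian.trace_eq_sum_eigenvalues, Finset.sum_sub_distrib]
    simp
  rw [h1, Real.exp_sum, hE.isHermitian.det_eq_prod_eigenvalues]
  refine Finset.prod_le_prod (fun i _ => hE.eigenvalues_nonneg i) fun i _ => ?_
  have := Real.add_one_le_exp (hE.isHermitian.eigenvalues i - 1)
  simpa using this

/-- D is the determinant of 1 - Cᵀ T⁻¹ C with C the column of coefficients. The trace of T bounds T
above, hence T⁻¹ below, so tr(Cᵀ T⁻¹ C) is at least a multiple of tr(Cᵀ C) = `traceSq x`. The bound
holds on the whole domain, which dominated convergence needs. -/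
theorem toeplitzRatio_le {x : Fin k → UpperIdx p → ℝ} (hx : x ∈ toeplitzDomain p k) :
    toeplitzRatio x ≤ Real.exp (-((k : ℝ) * p + 1)⁻¹ * traceSq x) := by
  set c := coeffSeq x
  -- The Toeplitz matrix has trace kp; the extra 1 keeps the constant positive when kp = 0.
  set t : ℝ := ((k : ℝ) * p + 1)⁻¹
  have ht : 0 < (k : ℝ) * p + 1 := by positivity
  have hA : (blockToeplitz c k).PosDef := blockToeplitz_posDef_of_succ hx
  have hAinv : (blockToeplitz c k) * (blockToeplitz c k)⁻¹ = 1 :=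
    mul_nonsing_inv _ ((isUnit_iff_isUnit_det _).1 hA.isUnit)
  have hAinv' : (blockToeplitz c k)⁻¹ * (blockToeplitz c k) = 1 :=
    nonsing_inv_mul _ ((isUnit_iff_isUnit_det _).1 hA.isUnit)
  have h1 : (((k : ℝ) * p + 1) • (1 : Matrix (Fin k × Fin p) (Fin k × Fin p) ℝ) -
      blockToeplitz c k).PosSemidef := by
    refine posSemidef_smul_one_sub hA.posSemidef ?_
    rw [trace_blockToeplitz, show c 0 = 1 from rfl]
    simp
  -- Uses the identity T⁻¹ - t = (T⁻¹ - t) T (T⁻¹ - t) + t² (t⁻¹ - T), a sum of nonnegative terms.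
  have h2 : ((blockToeplitz c k)⁻¹ - t • (1 : Matrix (Fin k × Fin p) (Fin k × Fin p) ℝ)).PosSemidef := by
    have h3 : ((blockToeplitz c k)⁻¹ - t • 1)ᴴ = (blockToeplitz c k)⁻¹ - t • 1 := by
      rw [conjTranspose_sub, hA.inv.isHermitian.eq, conjTranspose_smul]
      simp
    have h4 := hA.posSemidef.conjTranspose_mul_mul_same ((blockToeplitz c k)⁻¹ - t • 1)
    have h5 := h4.add (h1.smul (sq_nonneg t))
    convert h5 using 1
    rw [h3, Matrix.sub_mul, hAinv', Matrix.sub_mul, Matrix.one_mul, Matrix.mul_sub,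
      Matrix.smul_mul, Matrix.one_mul, Matrix.smul_mul, hAinv, Matrix.mul_smul, Matrix.mul_one,
      smul_sub, smul_smul]
    have h6 : t ^ 2 * ((k : ℝ) * p + 1) = t := by
      simp only [t]
      field_simp
    rw [smul_smul, h6, ← sq]
    abel
  have h7 : (toeplitzSchur c k - 1).trace ≤ -t * traceSq x := by
    have h8 := (h2.conjTranspose_mul_mul_same (toeplitzCol c k)).trace_nonneg
    rw [conjTranspose_eq_transpose_of_trivial, Matrix.mul_sub, Matrix.sub_mul, trace_sub,
      Matrix.mul_smul, Matrix.smul_mul, Matrix.mul_one, trace_smul,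
      trace_transpose_toeplitzCol_mul (coeffSeq_isSymm x)] at h8
    have h9 : ∑ i : Fin k, (coeffSeq x ((i : ℕ) + 1) ^ 2).trace = traceSq x :=
      Finset.sum_congr rfl fun i _ => by rw [coeffSeq_succ x i.2]
    rw [h9, smul_eq_mul] at h8
    rw [toeplitzSchur, sub_sub_cancel_left, trace_neg]
    linarith
  rw [toeplitzRatio_eq hx]
  exact (det_le_exp_trace_sub_one (toeplitzSchur_posDef hx).posSemidef).trans
    (Real.exp_le_exp.2 h7)

theorem toeplitzWeight_le {s : ℝ} (hs : 0 ≤ s) (x : Fin k → UpperIdx p → ℝ) :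
    toeplitzWeight s x ≤
      ENNReal.ofReal (Real.exp (-(s * ((k : ℝ) * p + 1)⁻¹ * traceSq x))) := by
  by_cases hx : x ∈ toeplitzDomain p k
  · rw [toeplitzWeight, Set.indicator_of_mem hx]
    refine ENNReal.ofReal_le_ofReal ?_
    refine (Real.rpow_le_rpow (toeplitzRatio_pos hx).le (toeplitzRatio_le hx) hs).trans_eq ?_
    rw [← Real.exp_mul]
    congr 1
    ring
  · rw [toeplitzWeight, Set.indicator_of_notMem hx]
    exact bot_le

theorem traceSq_smul (ε : ℝ) (y : Fin k → UpperIdx p → ℝ) :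
    traceSq (ε • y) = ε ^ 2 * traceSq y := by
  simp only [traceSq, Pi.smul_apply, map_smul, smul_pow, trace_smul, smul_eq_mul, Finset.mul_sum]

theorem sum_sq_le_traceSq (y : Fin k → UpperIdx p → ℝ) : ∑ i, ∑ q, y i q ^ 2 ≤ traceSq y := by
  refine Finset.sum_le_sum fun i _ => ?_
  rw [sq, trace_symMatrix_mul]
  refine Finset.sum_le_sum fun q _ => ?_
  nlinarith [one_le_upperWeight q, sq_nonneg (y i q)]

theorem continuous_traceSq : Continuous (traceSq (p := p) (k := k)) :=
  continuous_finsetSum _ fun i _ =>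
    ((continuous_symMatrix.comp (continuous_apply i)).pow 2).matrix_trace

theorem integrable_exp_neg_mul_traceSq {a : ℝ} (ha : 0 < a) :
    Integrable fun y : Fin k → UpperIdx p → ℝ => Real.exp (-(a * traceSq y)) := by
  have h1 : Integrable fun y : Fin k → UpperIdx p → ℝ => ∏ i, ∏ q, Real.exp (-a * y i q ^ 2) :=
    Integrable.fintype_prod (μ := fun _ => volume)
      (f := fun _ (z : UpperIdx p → ℝ) => ∏ q, Real.exp (-a * z q ^ 2)) fun _ =>
        Integrable.fintype_prod (μ := fun _ => volume)
          (f := fun _ (z : ℝ) => Real.exp (-a * z ^ 2)) fun _ => integrable_exp_neg_mul_sq ha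
  refine h1.mono' (by
    exact (Real.continuous_exp.comp (continuous_const.mul continuous_traceSq).neg).aestronglyMeasurable)
    (Eventually.of_forall fun y => ?_)
  rw [Real.norm_eq_abs, Real.abs_exp]
  simp only [← Real.exp_sum]
  refine Real.exp_le_exp.2 ?_
  simp only [neg_mul, Finset.sum_neg_distrib, ← Finset.mul_sum]
  have := mul_le_mul_of_nonneg_left (sum_sq_le_traceSq y) ha.le
  linarith

end Asymptotics

/-! ### The boundary of the Toeplitz domain has measure zero -/

section NullBoundary

open Matrix

variable {p n : ℕ}

theorem blockToeplitz_coeffSeq_add_smul (x y : Fin n → UpperIdx p → ℝ) {a b : ℝ} (hab : a + b = 1)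
    (N : ℕ) : blockToeplitz (coeffSeq (a • x + b • y)) N =
      a • blockToeplitz (coeffSeq x) N + b • blockToeplitz (coeffSeq y) N := by
  have h : ∀ m, coeffSeq (a • x + b • y) m = a • coeffSeq x m + b • coeffSeq y m := by
    rintro (_ | m)
    · simp only [coeffSeq_zero]
      rw [← add_smul, hab, one_smul]
    · simp only [coeffSeq]
      split_ifs <;> simp
  ext ⟨i, a⟩ ⟨j, b⟩
  simp only [blockToeplitz, of_apply, h, Matrix.add_apply, Matrix.smul_apply]

theorem convex_setOf_blockToeplitz_posSemidef (p n N : ℕ) :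
    Convex ℝ {x : Fin n → UpperIdx p → ℝ | (blockToeplitz (coeffSeq x) N).PosSemidef} := by
  intro x hx y hy a b ha hb hab
  rw [Set.mem_ofPred_eq, blockToeplitz_coeffSeq_add_smul x y hab]
  exact (PosSemidef.smul hx ha).add (PosSemidef.smul hy hb)

theorem toeplitzDomain_subset (p n : ℕ) : toeplitzDomain p n ⊆
    {x | (blockToeplitz (coeffSeq x) (n + 1)).PosSemidef} := fun _ hx => PosDef.posSemidef hx

/-- At an interior point x some (1+t)x with t > 0 is still in the set, and x is a convex combination
of it and 0. The Toeplitz matrix of 0 is the identity, so that of x is strictly positive. -/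
theorem interior_setOf_blockToeplitz_posSemidef_subset (p n : ℕ) :
    interior {x : Fin n → UpperIdx p → ℝ | (blockToeplitz (coeffSeq x) (n + 1)).PosSemidef} ⊆
      toeplitzDomain p n := by
  intro x hx
  have hc : Tendsto (fun t : ℝ => (1 + t) • x) (nhdsWithin 0 (Set.Ioi 0)) (nhds x) := by
    have : Continuous fun t : ℝ => (1 + t) • x := by fun_prop
    simpa using (this.tendsto 0).mono_left nhdsWithin_le_nhds
  obtain ⟨t, ht, ht0⟩ := ((hc.eventually (isOpen_interior.mem_nhds hx)).and
    self_mem_nhdsWithin).exists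
  have ht0' : 0 < t := ht0
  have h1 : (1 + t) • x ∈ {x : Fin n → UpperIdx p → ℝ |
      (blockToeplitz (coeffSeq x) (n + 1)).PosSemidef} := interior_subset ht
  rw [Set.mem_ofPred_eq] at h1
  have h0 : (1 + t)⁻¹ + t * (1 + t)⁻¹ = 1 := by field_simp
  have h2 := blockToeplitz_coeffSeq_add_smul ((1 + t) • x) 0 h0 (n + 1)
  rw [smul_smul, inv_mul_cancel₀ (by positivity), one_smul, smul_zero, add_zero] at h2
  have h3 : blockToeplitz (coeffSeq (0 : Fin n → UpperIdx p → ℝ)) (n + 1) = 1 := by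
    have := blockToeplitz_coeffSeq_smul (0 : Fin n → UpperIdx p → ℝ) 0 (n + 1)
    simpa using this
  rw [h3] at h2
  rw [toeplitzDomain, Set.mem_ofPred_eq, h2]
  exact PosDef.posSemidef_add (h1.smul (by positivity)) (PosDef.one.smul (by positivity))

theorem toeplitzDomain_ae_eq (p n : ℕ) : (toeplitzDomain p n : Set _) =ᵐ[volume]
    {x : Fin n → UpperIdx p → ℝ | (blockToeplitz (coeffSeq x) (n + 1)).PosSemidef} := by
  refine ae_eq_set.2 ⟨?_, ?_⟩
  · rw [Set.sdiff_eq_empty.2 (toeplitzDomain_subset p n), measure_empty]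
  · refine measure_mono_null ?_
      ((convex_setOf_blockToeplitz_posSemidef p n (n + 1)).addHaar_frontier volume)
    rw [(isClosed_setOf_blockToeplitz_posSemidef p n (n + 1)).frontier_eq]
    exact Set.sdiff_subset_sdiff_right (interior_setOf_blockToeplitz_posSemidef_subset p n)

end NullBoundary

/-! ### Transport of the uniform law to Chebyshev coordinates -/

section Transport

variable {p n : ℕ}

theorem continuous_symOfUpper (p : ℕ) : Continuous (symOfUpper p) :=
  Continuous.subtype_mk continuous_symMatrix _

/-- Tuples of symmetric matrices are measurably the tuples of their entries on and above the
diagonal. -/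
def symTupleEquiv (p n : ℕ) : (Fin n → UpperIdx p → ℝ) ≃ᵐ (Fin n → SymMat p) where
  toFun x i := symOfUpper p (x i)
  invFun X i q := (X i : Matrix (Fin p) (Fin p) ℝ) q.1.1 q.1.2
  left_inv x := by
    ext i q
    exact symMatrix_apply_upper _ _
  right_inv X := by
    ext1 i
    exact Subtype.ext (symMatrix_upper (X i).2)
  measurable_toFun := measurable_pi_lambda _ fun i =>
    (measurable_symOfUpper p).comp (measurable_pi_apply i)
  measurable_invFun := measurable_pi_lambda _ fun i => measurable_pi_lambda _ fun q => by
    have : Continuous fun X : SymMat p => (X : Matrix (Fin p) (Fin p) ℝ) q.1.1 q.1.2 :=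
      continuous_subtype_val.matrix_elem q.1.1 q.1.2
    exact this.measurable.comp (measurable_pi_apply i)

theorem symTupleEquiv_apply (x : Fin n → UpperIdx p → ℝ) (i : Fin n) :
    symTupleEquiv p n x i = symOfUpper p (x i) := rfl

theorem continuous_symTupleEquiv (p n : ℕ) : Continuous (symTupleEquiv p n) :=
  continuous_pi fun i => (continuous_symOfUpper p).comp (continuous_apply i)

theorem measurableEmbedding_symOfUpper (p : ℕ) : MeasurableEmbedding (symOfUpper p) := by
  let e : (UpperIdx p → ℝ) ≃ᵐ SymMat p :=
    { toFun := symOfUpper p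
      invFun := fun X q => (X : Matrix (Fin p) (Fin p) ℝ) q.1.1 q.1.2
      left_inv := fun x => by
        ext q
        exact symMatrix_apply_upper _ _
      right_inv := fun X => Subtype.ext (symMatrix_upper X.2)
      measurable_toFun := measurable_symOfUpper p
      measurable_invFun := measurable_pi_lambda _ fun q => by
        have : Continuous fun X : SymMat p => (X : Matrix (Fin p) (Fin p) ℝ) q.1.1 q.1.2 :=
          continuous_subtype_val.matrix_elem q.1.1 q.1.2
        exact this.measurable }
  exact e.measurableEmbedding

theorem symTupleVolume_eq_map (p n : ℕ) :
    symTupleVolume p n = Measure.map (symTupleEquiv p n) volume := by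
  have : SigmaFinite (Measure.map (symOfUpper p) volume) :=
    (measurableEmbedding_symOfUpper p).sigmaFinite_map
  exact (Measure.pi_map_pi (μ := fun _ : Fin n => (volume : Measure (UpperIdx p → ℝ)))
    (f := fun _ => symOfUpper p) fun _ => (measurable_symOfUpper p).aemeasurable).symm

/-- The action of a matrix on tuples of coordinate vectors. -/
def tupleAct (p : ℕ) (B : Matrix (Fin n) (Fin n) ℝ) :
    (Fin n → UpperIdx p → ℝ) →ₗ[ℝ] (Fin n → UpperIdx p → ℝ) where
  toFun x i := ∑ j, B i j • x j
  map_add' x y := by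
    ext1 i
    simp [Finset.sum_add_distrib]
  map_smul' r x := by
    ext1 i
    simp [Finset.smul_sum, smul_comm r]

theorem tupleAct_tupleAct (B C : Matrix (Fin n) (Fin n) ℝ) (x : Fin n → UpperIdx p → ℝ) :
    tupleAct p B (tupleAct p C x) = tupleAct p (B * C) x := by
  ext i q
  simp only [tupleAct, LinearMap.coe_mk, AddHom.coe_mk, Matrix.mul_apply, Finset.sum_apply,
    Pi.smul_apply, smul_eq_mul, Finset.mul_sum, Finset.sum_mul, mul_assoc]
  exact Finset.sum_comm

theorem tupleAct_one (x : Fin n → UpperIdx p → ℝ) : tupleAct p (1 : Matrix (Fin n) (Fin n) ℝ) x = x := by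
  ext1 i
  simp [tupleAct, Matrix.one_apply]

theorem det_tupleAct_ne_zero {B : Matrix (Fin n) (Fin n) ℝ} (hB : B.det ≠ 0) :
    LinearMap.det (tupleAct p B) ≠ 0 := by
  have h : tupleAct p B⁻¹ ∘ₗ tupleAct p B = LinearMap.id := by
    refine LinearMap.ext fun x => ?_
    rw [LinearMap.comp_apply, tupleAct_tupleAct, Matrix.nonsing_inv_mul _ (isUnit_iff_ne_zero.2 hB),
      tupleAct_one, LinearMap.id_apply]
  intro h0
  have h1 := congrArg LinearMap.det h
  rw [LinearMap.det_comp, h0, mul_zero, LinearMap.det_id] at h1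
  exact zero_ne_one h1

theorem momentParam_eq (x : Fin n → UpperIdx p → ℝ) :
    momentParam p n x = symTupleEquiv p n ((symTupleEquiv p n).symm (arcsineCenter p n) +
      tupleAct p ((2⁻¹ : ℝ) • coeffMatrix n) x) := by
  have hadd : ∀ x y : Fin n → UpperIdx p → ℝ,
      symTupleEquiv p n (x + y) = symTupleEquiv p n x + symTupleEquiv p n y := fun _ _ => rfl
  rw [hadd, MeasurableEquiv.apply_symm_apply]
  ext1 i
  apply Subtype.ext
  rw [coe_momentParam]
  simp only [Pi.add_apply, Submodule.coe_add, symTupleEquiv_apply, coe_symOfUpper]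
  congr 1
  simp [tupleAct]

theorem momentParam_eq_comp (p n : ℕ) : momentParam p n = symTupleEquiv p n ∘
    ((fun x => (symTupleEquiv p n).symm (arcsineCenter p n) + x) ∘
      tupleAct p ((2⁻¹ : ℝ) • coeffMatrix n)) :=
  funext momentParam_eq

theorem det_tupleAct_smul_coeffMatrix_ne_zero (p n : ℕ) :
    LinearMap.det (tupleAct p ((2⁻¹ : ℝ) • coeffMatrix n)) ≠ 0 :=
  det_tupleAct_ne_zero (by
    rw [Matrix.det_smul]
    exact mul_ne_zero (by positivity) (det_coeffMatrix_ne_zero n))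

theorem measurableEmbedding_momentParam (p n : ℕ) : MeasurableEmbedding (momentParam p n) := by
  rw [momentParam_eq_comp]
  refine (symTupleEquiv p n).measurableEmbedding.comp ((measurableEmbedding_addLeft _).comp ?_)
  have hinj : LinearMap.ker (tupleAct (n := n) p ((2⁻¹ : ℝ) • coeffMatrix n)) = ⊥ :=
    ((LinearMap.equivOfDetNeZero _ (det_tupleAct_smul_coeffMatrix_ne_zero p n)).ker)
  exact (LinearMap.isClosedEmbedding_of_injective hinj).measurableEmbedding

theorem exists_map_momentParam (p n : ℕ) : ∃ c : ENNReal, c ≠ 0 ∧ c ≠ ⊤ ∧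
    Measure.map (momentParam p n) volume = c • symTupleVolume p n := by
  have hdet := det_tupleAct_smul_coeffMatrix_ne_zero p n
  have hL := (LinearMap.continuous_of_finiteDimensional
    (tupleAct (n := n) p ((2⁻¹ : ℝ) • coeffMatrix n))).measurable
  refine ⟨ENNReal.ofReal |(LinearMap.det (tupleAct p ((2⁻¹ : ℝ) • coeffMatrix n)))⁻¹|, ?_,
    ENNReal.ofReal_ne_top, ?_⟩
  · simpa using hdet
  rw [momentParam_eq_comp, ← Measure.map_map (symTupleEquiv p n).measurable
    ((measurable_const_add _).comp hL), ← Measure.map_map (measurable_const_add _) hL,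
    Measure.map_linearMap_addHaar_eq_smul_addHaar volume hdet, Measure.map_smul, Measure.map_smul,
    map_add_left_eq_self, symTupleVolume_eq_map]

/-- The parametrization scales volume by a finite nonzero constant, which cancels when the
restricted measure is normalised. -/
theorem cond_symTupleVolume_momentSpace (p n : ℕ) :
    ProbabilityTheory.cond (symTupleVolume p n) (momentSpace p n) = Measure.map (momentParam p n)
      (ProbabilityTheory.cond volume {x | (blockToeplitz (coeffSeq x) (n + 1)).PosSemidef}) := by
  obtain ⟨c, hc0, hc, h⟩ := exists_map_momentParam p n
  have h' : symTupleVolume p n = c⁻¹ • Measure.map (momentParam p n) volume := by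
    rw [h, smul_smul, ENNReal.inv_mul_cancel hc0 hc, one_smul]
  have he := measurableEmbedding_momentParam p n
  have hpre : momentParam p n ⁻¹' momentSpace p n =
      {x | (blockToeplitz (coeffSeq x) (n + 1)).PosSemidef} := by
    rw [momentSpace_eq_image, Set.preimage_image_eq _ he.injective]
  rw [h', ProbabilityTheory.cond, ProbabilityTheory.cond, Measure.restrict_smul, smul_smul, Measure.smul_apply, he.map_apply,
    he.restrict_map, hpre, Measure.map_smul, smul_eq_mul, ENNReal.mul_inv, inv_inv, mul_right_comm,
    ENNReal.mul_inv_cancel hc0 hc, one_mul]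
  · exact Or.inl (ENNReal.inv_ne_zero.2 hc)
  · exact Or.inl (ENNReal.inv_ne_top.2 hc0)

end Transport

/-! ### Convergence in distribution from convergence of densities -/

section DensityConvergence

open scoped Topology BoundedContinuousFunction NNReal

/-- Scheffé's principle: convergence of unnormalized dominated densities implies convergence in
distribution of the normalized measures. -/
theorem tendsto_probabilityMeasure_of_tendsto_density {E : Type*} [TopologicalSpace E]
    [MeasurableSpace E] [OpensMeasurableSpace E] {ρ : Measure E} {ι : Type*} {l : Filter ι}
    [l.IsCountablyGenerated] {μ : ι → ProbabilityMeasure E} {ν : ProbabilityMeasure E}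
    {c : ι → ENNReal} {c₀ : ENNReal} {g : ι → E → ENNReal} {g₀ bound : E → ENNReal}
    (hg : ∀ i, Measurable (g i)) (hg₀ : Measurable g₀)
    (hμ : ∀ᶠ i in l, (μ i : Measure E) = c i • ρ.withDensity (g i))
    (hν : (ν : Measure E) = c₀ • ρ.withDensity g₀)
    (hbound : ∀ᶠ i in l, ∀ x, g i x ≤ bound x) (hfin : ∫⁻ x, bound x ∂ρ ≠ ⊤)
    (hlim : ∀ x, Tendsto (fun i => g i x) l (𝓝 (g₀ x))) : Tendsto μ l (𝓝 ν) := by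
  have hlint : ∀ {c : ENNReal} {g : E → ENNReal} (hg : Measurable g) (f : E →ᵇ ℝ≥0),
      ∫⁻ x, f x ∂(c • ρ.withDensity g) = c * ∫⁻ x, g x * f x ∂ρ := fun hg f => by
    rw [lintegral_smul_measure, lintegral_withDensity_eq_lintegral_mul _ hg
      f.measurable_coe_ennreal_comp, smul_eq_mul]
    rfl
  have hJ : ∀ f : E →ᵇ ℝ≥0, Tendsto (fun i => ∫⁻ x, g i x * f x ∂ρ) l
      (𝓝 (∫⁻ x, g₀ x * f x ∂ρ)) := fun f => by
    refine tendsto_lintegral_filter_of_dominated_convergence (fun x => bound x * nndist 0 f)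
      (Eventually.of_forall fun i => (hg i).mul f.measurable_coe_ennreal_comp)
      (hbound.mono fun i hi => ae_of_all _ fun x => ?_) ?_ (ae_of_all _ fun x => ?_)
    · exact mul_le_mul' (hi x) (ENNReal.coe_le_coe.2 (f.apply_le_nndist_zero x))
    · rw [lintegral_mul_const' _ _ ENNReal.coe_ne_top]
      exact ENNReal.mul_ne_top hfin ENNReal.coe_ne_top
    · exact ENNReal.Tendsto.mul_const (hlim x) (Or.inr ENNReal.coe_ne_top)
  -- Total mass one forces the constants, so their convergence follows from that of the integrals
  -- and need not be assumed.
  have hone : ∀ {μ : ProbabilityMeasure E} {c : ENNReal} {g : E → ENNReal},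
      (μ : Measure E) = c • ρ.withDensity g → c = (∫⁻ x, g x ∂ρ)⁻¹ := fun {μ c g} h => by
    have h1 : (μ : Measure E) Set.univ = 1 := measure_univ
    rw [h, Measure.smul_apply, withDensity_apply _ MeasurableSet.univ, Measure.restrict_univ,
      smul_eq_mul] at h1
    exact ENNReal.eq_inv_of_mul_eq_one_left h1
  have hJ1 : Tendsto (fun i => ∫⁻ x, g i x ∂ρ) l (𝓝 (∫⁻ x, g₀ x ∂ρ)) := by
    simpa using hJ (BoundedContinuousFunction.const E 1)
  have hc : Tendsto c l (𝓝 c₀) := by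
    rw [hone hν]
    exact (tendsto_inv_iff.2 hJ1).congr' (hμ.mono fun i hi => (hone hi).symm)
  have hmass : c₀ * ∫⁻ x, g₀ x ∂ρ = 1 := by
    have h1 : (ν : Measure E) Set.univ = 1 := measure_univ
    rwa [hν, Measure.smul_apply, withDensity_apply _ MeasurableSet.univ, Measure.restrict_univ,
      smul_eq_mul] at h1
  have hc₀ : c₀ ≠ 0 := left_ne_zero_of_mul (hmass.trans_ne one_ne_zero)
  have hI : ∫⁻ x, g₀ x ∂ρ ≠ 0 := right_ne_zero_of_mul (hmass.trans_ne one_ne_zero)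
  have hc₀' : c₀ ≠ ⊤ := by
    rw [hone hν]
    exact ENNReal.inv_ne_top.2 hI
  rw [ProbabilityMeasure.tendsto_iff_forall_lintegral_tendsto]
  intro f
  rw [hν, hlint hg₀]
  refine (ENNReal.Tendsto.mul hc (Or.inl hc₀) (hJ f) (Or.inr hc₀')).congr' ?_
  filter_upwards [hμ] with i hi
  rw [hi, hlint (hg i)]

end DensityConvergence

/-! ### The product of Gaussian orthogonal ensembles in coordinates -/

section LimitLaw

open Matrix

variable {p k : ℕ}

/-- The density of a member of the Gaussian orthogonal ensemble in coordinates. -/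
def goeDensity (p : ℕ) (z : UpperIdx p → ℝ) : ℝ :=
  (2 * Real.pi) ^ (-(p : ℝ) / 2) * Real.pi ^ (-((p : ℝ) * ((p : ℝ) - 1)) / 4) *
    Real.exp (-(1 / 2) * (symMatrix p z ^ 2).trace)

theorem goeDensity_nonneg (z : UpperIdx p → ℝ) : 0 ≤ goeDensity p z := by
  unfold goeDensity
  positivity

theorem withDensity_map_of_measurableEmbedding {α β : Type*} [MeasurableSpace α] [MeasurableSpace β]
    {f : α → β} (hf : MeasurableEmbedding f) (μ : Measure α) (g : β → ENNReal) :
    (μ.map f).withDensity g = (μ.withDensity (g ∘ f)).map f := by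
  ext s hs
  rw [withDensity_apply _ hs, hf.map_apply, withDensity_apply _ (hf.measurable hs),
    hf.restrict_map, hf.lintegral_map]
  rfl

theorem goe_eq_map (p : ℕ) : goe p = Measure.map (symOfUpper p)
    (volume.withDensity fun z => ENNReal.ofReal (goeDensity p z)) :=
  withDensity_map_of_measurableEmbedding (measurableEmbedding_symOfUpper p) _ _

theorem integrable_goeDensity (p : ℕ) : Integrable (goeDensity p) := by
  have h := integrable_exp_neg_mul_traceSq (p := p) (k := 1) (a := 1 / 2) (by norm_num)
  have h2 := (volume_preserving_funUnique (Fin 1) (UpperIdx p → ℝ)).symm.integrable_comp_emb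
    (MeasurableEquiv.measurableEmbedding _) |>.2 h
  refine (h2.const_mul ((2 * Real.pi) ^ (-(p : ℝ) / 2) *
    Real.pi ^ (-((p : ℝ) * ((p : ℝ) - 1)) / 4))).congr (ae_of_all _ fun z => ?_)
  simp [goeDensity, traceSq, neg_mul]

theorem pi_withDensity_ofReal {ι E : Type*} [Fintype ι] [MeasureSpace E]
    [SigmaFinite (volume : Measure E)] {f : E → ℝ} (hf : Integrable f)
    (h0 : ∀ z, 0 ≤ f z) :
    (Measure.pi fun _ : ι => (volume : Measure E).withDensity fun z => ENNReal.ofReal (f z)) =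
      (volume : Measure (ι → E)).withDensity fun y => ENNReal.ofReal (∏ i, f (y i)) := by
  refine Measure.pi_eq fun s hs => ?_
  have hint : ∀ i, Integrable ((s i).indicator f) := fun i => hf.indicator (hs i)
  have h1 : ∀ y : ι → E, (Set.univ.pi s).indicator (fun y => ENNReal.ofReal (∏ i, f (y i))) y =
      ENNReal.ofReal (∏ i, (s i).indicator f (y i)) := fun y => by
    by_cases hy : y ∈ Set.univ.pi s
    · rw [Set.indicator_of_mem hy]
      congr 1
      exact Finset.prod_congr rfl fun i hi => (Set.indicator_of_mem (hy i trivial) _).symm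
    · rw [Set.indicator_of_notMem hy]
      obtain ⟨i, hi⟩ : ∃ i, y i ∉ s i := by simpa using hy
      rw [Finset.prod_eq_zero (Finset.mem_univ i) (Set.indicator_of_notMem hi _),
        ENNReal.ofReal_zero]
  rw [withDensity_apply _ (MeasurableSet.univ_pi hs),
    ← lintegral_indicator (MeasurableSet.univ_pi hs), lintegral_congr h1, volume_pi,
    ← ofReal_integral_eq_lintegral_ofReal (Integrable.fintype_prod hint)
      (ae_of_all _ fun y => Finset.prod_nonneg fun i _ => Set.indicator_nonneg (fun z _ => h0 z) _),
    integral_fintype_prod_eq_prod (fun i => (s i).indicator f),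
    ENNReal.ofReal_prod_of_nonneg fun i _ => integral_nonneg (Set.indicator_nonneg fun z _ => h0 z)]
  refine Finset.prod_congr rfl fun i _ => ?_
  rw [withDensity_apply _ (hs i), integral_indicator (hs i),
    ofReal_integral_eq_lintegral_ofReal hf.integrableOn (ae_of_all _ h0)]

/-- The GOE densities multiply to the exponential of the summed traces; only this shape matters, so
the constant stays existential. -/
theorem exists_pi_goe (p k : ℕ) : ∃ c : ENNReal, Measure.pi (fun _ : Fin k => goe p) =
    Measure.map (symTupleEquiv p k) (c • volume.withDensity fun y : Fin k → UpperIdx p → ℝ =>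
      ENNReal.ofReal (Real.exp (-(1 / 2) * traceSq y))) := by
  set C : ℝ := (2 * Real.pi) ^ (-(p : ℝ) / 2) * Real.pi ^ (-((p : ℝ) * ((p : ℝ) - 1)) / 4)
  refine ⟨ENNReal.ofReal (C ^ k), ?_⟩
  have hsig : SigmaFinite (Measure.map (symOfUpper p)
      (volume.withDensity fun z => ENNReal.ofReal (goeDensity p z))) :=
    (measurableEmbedding_symOfUpper p).sigmaFinite_map
  have h1 := Measure.pi_map_pi (ι := Fin k)
    (μ := fun _ => volume.withDensity fun z => ENNReal.ofReal (goeDensity p z))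
    (f := fun _ => symOfUpper p) fun _ => (measurable_symOfUpper p).aemeasurable
  rw [goe_eq_map, ← h1, pi_withDensity_ofReal (integrable_goeDensity p)
    goeDensity_nonneg]
  congr 1
  rw [← withDensity_smul _ (by
    exact (Real.continuous_exp.comp (continuous_const.mul continuous_traceSq)).measurable.ennreal_ofReal)]
  congr 1
  ext1 y
  rw [Pi.smul_apply, smul_eq_mul, ← ENNReal.ofReal_mul (by positivity)]
  congr 1
  simp only [goeDensity, Finset.prod_mul_distrib, Finset.prod_const, Finset.card_univ,
    Fintype.card_fin, traceSq, Finset.mul_sum, Real.exp_sum, C, mul_pow]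

end LimitLaw

/-! ### Projection to the first k moments and rescaling -/

section Rescaling

variable {p k : ℕ}

theorem coeffMatrix_castLE {n : ℕ} (h : k ≤ n) (i j : Fin k) :
    coeffMatrix n (Fin.castLE h i) (Fin.castLE h j) = coeffMatrix k i j := by
  simp only [coeffMatrix, Matrix.of_apply, Fin.val_castLE, Fin.castLE_le_castLE_iff]

theorem sum_coeffMatrix_castLE {n : ℕ} (h : k ≤ n) {V : Type*} [AddCommGroup V] [Module ℝ V]
    (v : Fin n → V) (i : Fin k) : ∑ j, coeffMatrix n (Fin.castLE h i) j • v j =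
      ∑ j, coeffMatrix k i j • v (Fin.castLE h j) := by
  obtain ⟨d, rfl⟩ := Nat.exists_eq_add_of_le h
  rw [Fin.sum_univ_add]
  have h0 : ∀ j : Fin d, coeffMatrix (k + d) (Fin.castLE h i) (Fin.natAdd k j) = 0 := fun j => by
    rw [coeffMatrix, Matrix.of_apply, if_neg]
    rw [Fin.le_def, Fin.val_natAdd, Fin.val_castLE]
    omega
  simp only [h0, zero_smul, Finset.sum_const_zero, add_zero]
  exact Finset.sum_congr rfl fun j _ => by rw [← coeffMatrix_castLE h]; rfl

/-- By triangularity the first k moments involve only the first k Chebyshev moments, through the k ×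
k corner, which the inverse removes. The factor 2 undoes the 1/2 in `momentParam`. -/
theorem kronAct_inv_momentParam {n : ℕ} (h : k ≤ n) (x : Fin n → UpperIdx p → ℝ) (r : ℝ) :
    (2 * r) • kronAct (coeffMatrix k)⁻¹
      ((fun i : Fin k => momentParam p n x (Fin.castLE h i)) - arcsineCenter p k) =
      symTupleEquiv p k (r • fun i => x (Fin.castLE h i)) := by
  have h1 : (fun i : Fin k => momentParam p n x (Fin.castLE h i)) - arcsineCenter p k =
      fun i => (2⁻¹ : ℝ) • ∑ j, coeffMatrix k i j • symOfUpper p (x (Fin.castLE h j)) := by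
    ext1 i
    rw [← sum_coeffMatrix_castLE h fun j => symOfUpper p (x j)]
    simp [momentParam, arcsineCenter, kronAct]
  rw [h1]
  ext1 i
  have h2 : ∀ j, ∑ l, (coeffMatrix k)⁻¹ i l * coeffMatrix k l j = (1 : Matrix _ _ ℝ) i j :=
    fun j => by
      rw [← Matrix.mul_apply, Matrix.nonsing_inv_mul _
        (isUnit_iff_ne_zero.2 (det_coeffMatrix_ne_zero k))]
  have h3 : ∑ l, (coeffMatrix k)⁻¹ i l • ∑ j, coeffMatrix k l j • symOfUpper p (x (Fin.castLE h j)) =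
      symOfUpper p (x (Fin.castLE h i)) := by
    simp only [Finset.smul_sum, smul_smul]
    rw [Finset.sum_comm]
    simp only [← Finset.sum_smul, h2]
    simp [Matrix.one_apply]
  have h4 : kronAct (coeffMatrix k)⁻¹ (fun i => (2⁻¹ : ℝ) • ∑ j, coeffMatrix k i j •
      symOfUpper p (x (Fin.castLE h j))) i = (2⁻¹ : ℝ) • symOfUpper p (x (Fin.castLE h i)) := by
    rw [← h3, kronAct, Finset.smul_sum]
    exact Finset.sum_congr rfl fun l _ => smul_comm _ _ _
  rw [Pi.smul_apply, h4, smul_smul, mul_right_comm, mul_inv_cancel₀ two_ne_zero, one_mul]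
  rfl

theorem continuous_smul_kronAct_castLE {n : ℕ} (h : k ≤ n) (r : ℝ) :
    Continuous fun X : Fin n → SymMat p => r • kronAct (coeffMatrix k)⁻¹
      ((fun i : Fin k => X (Fin.castLE h i)) - arcsineCenter p k) := by
  have hsub : ∀ j : Fin k, Continuous fun X : Fin n → SymMat p =>
      X (Fin.castLE h j) - arcsineCenter p k j := fun j =>
    (continuous_apply (Fin.castLE h j)).sub continuous_const
  refine continuous_pi fun i => ?_
  have hsum : Continuous fun X : Fin n → SymMat p => ∑ j, (coeffMatrix k)⁻¹ i j •
      (X (Fin.castLE h j) - arcsineCenter p k j) :=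
    continuous_finsetSum _ fun j _ => (continuous_const_smul ((coeffMatrix k)⁻¹ i j)).comp (hsub j)
  exact (continuous_const_smul r).comp hsum

/-- The law of the rescaled first Chebyshev moments. -/
theorem exists_map_restrict_eq_withDensity {n : ℕ} (h : k ≤ n) {r : ℝ} (hr : r ≠ 0) :
    ∃ c : ENNReal, Measure.map (fun x : Fin n → UpperIdx p → ℝ => r • fun i : Fin k =>
        x (Fin.castLE h i))
        (ProbabilityTheory.cond volume {x | (blockToeplitz (coeffSeq x) (n + 1)).PosSemidef}) =
      c • (volume : Measure (Fin k → UpperIdx p → ℝ)).withDensity fun y =>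
        toeplitzWeight (((n : ℝ) - k) * (((p : ℝ) + 1) / 2)) (r⁻¹ • y) := by
  obtain ⟨d, rfl⟩ := Nat.exists_eq_add_of_le h
  -- At exponent 0 the weight is the indicator of `toeplitzDomain`, that is, the uniform law up to a
  -- null set; integrating out d = n - k coefficients gives exponent d(p+1)/2.
  obtain ⟨c, hc⟩ := exists_lintegral_toeplitzWeight (p := p) k d 0
  set K := {x : Fin (k + d) → UpperIdx p → ℝ | (blockToeplitz (coeffSeq x) (k + d + 1)).PosSemidef}
  refine ⟨(volume K)⁻¹ * c *
    ENNReal.ofReal |(r ^ Module.finrank ℝ (Fin k → UpperIdx p → ℝ))⁻¹|, ?_⟩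
  have hm : Measurable fun x : Fin (k + d) → UpperIdx p → ℝ => r • fun i : Fin k =>
      x (Fin.castLE h i) :=
    (measurable_pi_lambda _ fun i => measurable_pi_apply _).const_smul r
  have hw : Measurable fun y : Fin k → UpperIdx p → ℝ =>
      toeplitzWeight ((((k + d : ℕ) : ℝ) - k) * (((p : ℝ) + 1) / 2)) (r⁻¹ • y) :=
    (measurable_toeplitzWeight _).comp (measurable_const_smul _)
  refine Measure.ext_of_lintegral _ fun ψ hψ => ?_
  have hψr : Measurable fun y : Fin k → UpperIdx p → ℝ => ψ (r • y) :=
    hψ.comp (measurable_const_smul r)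
  have h0 : ∀ x : Fin (k + d) → UpperIdx p → ℝ, toeplitzWeight 0 x =
      (toeplitzDomain p (k + d)).indicator 1 x := fun x => by
    unfold toeplitzWeight
    congr 1
    ext1 z
    simp
  have h1 : ∫⁻ x in K, ψ (r • fun i : Fin k => x (Fin.castLE h i)) =
      c * ∫⁻ y, ψ (r • y) * toeplitzWeight (0 + d * (((p : ℝ) + 1) / 2)) y := by
    rw [← hc _ hψr, ← setLIntegral_congr (toeplitzDomain_ae_eq p (k + d)),
      ← lintegral_indicator (measurableSet_toeplitzDomain p _)]
    refine lintegral_congr fun x => ?_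
    rw [h0]
    by_cases hx : x ∈ toeplitzDomain p (k + d)
    · simp only [Set.indicator_of_mem hx, Pi.one_apply, mul_one]
      rfl
    · simp only [Set.indicator_of_notMem hx, mul_zero]
  have h2 : ∫⁻ y, ψ (r • y) * toeplitzWeight (0 + d * (((p : ℝ) + 1) / 2)) y =
      ENNReal.ofReal |(r ^ Module.finrank ℝ (Fin k → UpperIdx p → ℝ))⁻¹| *
        ∫⁻ y, toeplitzWeight ((((k + d : ℕ) : ℝ) - k) * (((p : ℝ) + 1) / 2)) (r⁻¹ • y) * ψ y := by
    rw [← smul_eq_mul (a := ENNReal.ofReal _), ← lintegral_smul_measure,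
      ← Measure.map_addHaar_smul volume hr, lintegral_map (by exact hw.mul hψ)
      (measurable_const_smul r)]
    refine lintegral_congr fun y => ?_
    rw [smul_smul, inv_mul_cancel₀ hr, one_smul, mul_comm]
    congr 2
    push_cast
    ring
  rw [lintegral_map hψ hm, ProbabilityTheory.cond, lintegral_smul_measure, lintegral_smul_measure,
    lintegral_withDensity_eq_lintegral_mul _ hw hψ, h1, h2, smul_eq_mul, smul_eq_mul, mul_assoc,
    mul_assoc]
  rfl

end Rescaling

end

/-! ### The limit theorem -/

theorem theorem2p2 (p k : ℕ)
    {Ω : ℕ → Type*} [∀ n, MeasurableSpace (Ω n)]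
    (P : ∀ n, Measure (Ω n)) [∀ n, IsProbabilityMeasure (P n)]
    (S : ∀ n, Ω n → Fin n → SymMat p)
    (hSm : ∀ n, AEMeasurable (S n) (P n))
    (hS : ∀ n, pdf.IsUniform (S n) (momentSpace p n) (P n) (symTupleVolume p n))
    {Ω' : Type*} [MeasurableSpace Ω'] (P' : Measure Ω') [IsProbabilityMeasure P']
    (G : Fin k → Ω' → SymMat p)
    (hG : ∀ i, HasLaw (G i) (goe p) P')
    (hGindep : iIndepFun G P') :
    TendstoInDistribution
      (fun (n : Set.Ici k) (ω : Ω n) =>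
        √(4 * ((n : ℕ) : ℝ) * ((p : ℝ) + 1)) •
          kronAct (coeffMatrix k)⁻¹
            ((fun i : Fin k => S n ω (Fin.castLE n.2 i)) - arcsineCenter p k))
      atTop (fun ω i => G i ω) (fun n : Set.Ici k => P n) P' := by
  have hYm : ∀ n : Set.Ici k, Measurable fun X : Fin n → SymMat p =>
      √(4 * ((n : ℕ) : ℝ) * ((p : ℝ) + 1)) • kronAct (coeffMatrix k)⁻¹
        ((fun i : Fin k => X (Fin.castLE n.2 i)) - arcsineCenter p k) := fun n =>
    (continuous_smul_kronAct_castLE n.2 _).measurable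
  have hGm : AEMeasurable (fun ω i => G i ω) P' := aemeasurable_pi_lambda _ fun i => (hG i).aemeasurable
  have hX : ∀ n : Set.Ici k, AEMeasurable (fun ω => √(4 * ((n : ℕ) : ℝ) * ((p : ℝ) + 1)) •
      kronAct (coeffMatrix k)⁻¹ ((fun i : Fin k => S n ω (Fin.castLE n.2 i)) - arcsineCenter p k))
      (P n) := fun n => (hYm n).comp_aemeasurable (hSm n)
  refine ⟨hX, hGm, ?_⟩
  set r : ℕ → ℝ := fun n => √((n : ℝ) * ((p : ℝ) + 1))
  have hr : ∀ n : ℕ, √(4 * (n : ℝ) * ((p : ℝ) + 1)) = 2 * r n := fun n => by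
    rw [mul_assoc, Real.sqrt_mul (by norm_num), show (4 : ℝ) = 2 ^ 2 by norm_num,
      Real.sqrt_sq (by norm_num)]
  set R : ∀ n : Set.Ici k, (Fin n → UpperIdx p → ℝ) → (Fin k → UpperIdx p → ℝ) :=
    fun n x => r n • fun i => x (Fin.castLE n.2 i)
  have hRm : ∀ n, Measurable (R n) := fun n =>
    (measurable_pi_lambda _ fun i => measurable_pi_apply _).const_smul (r n)
  have hlaw : ∀ n : Set.Ici k, (P n).map (fun ω => √(4 * ((n : ℕ) : ℝ) * ((p : ℝ) + 1)) •
      kronAct (coeffMatrix k)⁻¹ ((fun i : Fin k => S n ω (Fin.castLE n.2 i)) - arcsineCenter p k)) =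
      Measure.map (symTupleEquiv p k) (Measure.map (R n) (ProbabilityTheory.cond volume
        {x | (blockToeplitz (coeffSeq x) (n + 1)).PosSemidef})) := fun n => by
    have h1 : (P n).map (S n) = Measure.map (momentParam p n) (ProbabilityTheory.cond volume
        {x | (blockToeplitz (coeffSeq x) (n + 1)).PosSemidef}) :=
      (hS n).trans (cond_symTupleVolume_momentSpace p n)
    rw [Measure.map_map (symTupleEquiv p k).measurable (hRm n)]
    refine ((AEMeasurable.map_map_of_aemeasurable (hYm n).aemeasurable (hSm n)).symm).trans ?_
    rw [h1, Measure.map_map (hYm n) (measurableEmbedding_momentParam p n).measurable]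
    congr 1
    ext1 x
    simp only [Function.comp_apply, hr]
    exact kronAct_inv_momentParam n.2 x (r n)
  obtain ⟨c₀, hc₀⟩ := exists_pi_goe p k
  have hlimlaw : P'.map (fun ω i => G i ω) = Measure.map (symTupleEquiv p k)
      (c₀ • volume.withDensity fun y : Fin k → UpperIdx p → ℝ =>
        ENNReal.ofReal (Real.exp (-(1 / 2) * traceSq y))) := by
    rw [(iIndepFun_iff_map_fun_eq_pi_map fun i => (hG i).aemeasurable).1 hGindep, ← hc₀]
    congr 1
    ext1 i
    exact (hG i).map_eq
  -- The coordinate measures inherit mass one from the laws of the random vectors, so no Gaussian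
  -- integral is evaluated.
  have hpull : ∀ {μ : Measure (Fin k → UpperIdx p → ℝ)},
      IsProbabilityMeasure (Measure.map (symTupleEquiv p k) μ) → IsProbabilityMeasure μ :=
    fun h => (Measure.isProbabilityMeasure_map_iff (symTupleEquiv p k).measurable.aemeasurable).1 h
  have hνn : ∀ n : Set.Ici k, IsProbabilityMeasure (Measure.map (R n) (ProbabilityTheory.cond volume
      {x | (blockToeplitz (coeffSeq x) (n + 1)).PosSemidef})) := fun n => hpull (by
    rw [← hlaw]
    exact Measure.isProbabilityMeasure_map (hX n))
  have hν : IsProbabilityMeasure (c₀ • volume.withDensity fun y : Fin k → UpperIdx p → ℝ =>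
      ENNReal.ofReal (Real.exp (-(1 / 2) * traceSq y))) := hpull (by
    rw [← hlimlaw]
    exact Measure.isProbabilityMeasure_map hGm)
  have hcoe : Tendsto (fun n : Set.Ici k => (n : ℕ)) atTop atTop := tendsto_comp_val_Ici_atTop.2 tendsto_id
  have hpos : ∀ n : ℕ, 0 < n → 0 < r n := fun n hn => Real.sqrt_pos.2 (by positivity)
  have key : Tendsto (β := ProbabilityMeasure (Fin k → UpperIdx p → ℝ))
      (fun n : Set.Ici k => ⟨_, hνn n⟩) atTop (nhds ⟨_, hν⟩) := by
    -- The case n = 0 is excluded because there the scale r vanishes; the formula is needed only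
    -- eventually.
    have hex : ∀ n : Set.Ici k, ∃ c : ENNReal, 0 < (n : ℕ) → Measure.map (R n)
        (ProbabilityTheory.cond volume {x | (blockToeplitz (coeffSeq x) (n + 1)).PosSemidef}) =
        c • (volume : Measure (Fin k → UpperIdx p → ℝ)).withDensity fun y =>
          toeplitzWeight ((((n : ℕ) : ℝ) - k) * (((p : ℝ) + 1) / 2)) ((r n)⁻¹ • y) := fun n => by
      by_cases hn : 0 < (n : ℕ)
      · obtain ⟨c, hc⟩ := exists_map_restrict_eq_withDensity (p := p) n.2 (hpos n hn).ne'
        exact ⟨c, fun _ => hc⟩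
      · exact ⟨0, fun h => absurd h hn⟩
    choose c hc using hex
    have hs : ∀ n : ℕ, 0 < n → ((n : ℝ) - k) * (((p : ℝ) + 1) / 2) * (r n)⁻¹ ^ 2 =
        1 / 2 - k / 2 * (n : ℝ)⁻¹ := fun n hn => by
      have : (0 : ℝ) < n := Nat.cast_pos.2 hn
      rw [inv_pow, Real.sq_sqrt (by positivity)]
      field_simp
    have hev : ∀ᶠ n : Set.Ici k in atTop, 0 < (n : ℕ) := hcoe.eventually (eventually_gt_atTop 0)
    have hinv : Tendsto (fun n : Set.Ici k => ((n : ℕ) : ℝ)⁻¹) atTop (nhds 0) :=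
      (tendsto_inv_atTop_zero.comp tendsto_natCast_atTop_atTop).comp hcoe
    refine tendsto_probabilityMeasure_of_tendsto_density (ρ := volume) (c := c) (c₀ := c₀)
      (g := fun n y => toeplitzWeight ((((n : ℕ) : ℝ) - k) * (((p : ℝ) + 1) / 2)) ((r n)⁻¹ • y))
      (g₀ := fun y => ENNReal.ofReal (Real.exp (-(1 / 2) * traceSq y)))
      (bound := fun y => ENNReal.ofReal (Real.exp (-(((k : ℝ) * p + 1)⁻¹ / 4 * traceSq y))))
      (fun n => (measurable_toeplitzWeight _).comp (measurable_const_smul _))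
      (Real.continuous_exp.comp
        (continuous_const.mul continuous_traceSq)).measurable.ennreal_ofReal
      (hev.mono fun n hn => hc n hn) rfl ?_ ?_ fun y => ?_
    -- For n ≥ 2k the exponent times the squared scale is at least 1/4, whence the 1/4 in the
    -- dominating Gaussian.
    · filter_upwards [hev, hcoe.eventually (eventually_ge_atTop (2 * k))] with n hn hnk y
      have h1 : (0 : ℝ) < (n : ℕ) := Nat.cast_pos.2 hn
      have h2 : 2 * (k : ℝ) ≤ (n : ℕ) := by exact_mod_cast hnk
      have h3 : 0 ≤ traceSq y := (Finset.sum_nonneg fun i _ => Finset.sum_nonneg fun q _ =>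
        sq_nonneg (y i q)).trans (sum_sq_le_traceSq y)
      have hk : (0 : ℝ) ≤ k := Nat.cast_nonneg k
      refine (toeplitzWeight_le (mul_nonneg (by linarith) (by positivity)) _).trans
        (ENNReal.ofReal_le_ofReal (Real.exp_le_exp.2 (neg_le_neg ?_)))
      have h4 : (1 : ℝ) / 4 ≤ 1 / 2 - k / 2 * ((n : ℕ) : ℝ)⁻¹ := by
        have : (k : ℝ) * ((n : ℕ) : ℝ)⁻¹ ≤ 1 / 2 := by
          rw [← div_eq_mul_inv, div_le_iff₀ h1]
          linarith
        linarith
      rw [← hs n hn] at h4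
      rw [traceSq_smul]
      have h5 : 0 ≤ ((k : ℝ) * p + 1)⁻¹ * traceSq y := by positivity
      nlinarith [mul_le_mul_of_nonneg_right h4 h5]
    · exact ((integrable_exp_neg_mul_traceSq (by positivity)).lintegral_lt_top).ne
    · refine tendsto_toeplitzWeight ?_ ?_ y
      · refine tendsto_nhdsWithin_iff.2 ⟨?_, hev.mono fun n hn => inv_ne_zero (hpos n hn).ne'⟩
        refine tendsto_inv_atTop_zero.comp (Real.tendsto_sqrt_atTop.comp ?_)
        exact ((tendsto_natCast_atTop_atTop.comp hcoe).atTop_mul_const (by positivity))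
      · have h1 : Tendsto (fun n : Set.Ici k => 1 / 2 - (k : ℝ) / 2 * ((n : ℕ) : ℝ)⁻¹) atTop
            (nhds (1 / 2)) := by
          have h2 := (hinv.const_mul ((k : ℝ) / 2)).const_sub (1 / 2)
          rwa [mul_zero, sub_zero] at h2
        exact h1.congr' (hev.mono fun n hn => (hs n hn).symm)
  have hmap := ProbabilityMeasure.tendsto_map_of_tendsto_of_continuous _ _ key
    (continuous_symTupleEquiv p k)
  have h1 : ∀ n : Set.Ici k, (⟨_, Measure.isProbabilityMeasure_map (hX n)⟩ : ProbabilityMeasure _) =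
      ProbabilityMeasure.map ⟨_, hνn n⟩ (symTupleEquiv p k).measurable.aemeasurable :=
    fun n => Subtype.ext (hlaw n)
  have h2 : (⟨_, Measure.isProbabilityMeasure_map hGm⟩ : ProbabilityMeasure _) =
      ProbabilityMeasure.map ⟨_, hν⟩ (symTupleEquiv p k).measurable.aemeasurable :=
    Subtype.ext hlimlaw
  rw [h2]
  exact hmap.congr fun n => (h1 n).symm
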